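/- Let $W$ be a one-dimensional Brownian motion on a probability space $(\Omega,\mathcal F,P)$, let $(\mathcal F_t)$ be the filtration generated by $W$, let $\Delta>0$, let $M\ge 1$ and $0\le m\le M-1$ be integers, $T=M\Delta$, and let $L\ge 0$ be an integer. For a smooth cylindrical variable $F=f(W(t_1),\dots,W(t_n))$ ($t_i\in[0,T]$, $f$ smooth with all derivatives of polynomial growth) the $k$-th Malliavin derivative is $D^k_{s_1,\dots,s_k}F=\sum_{i_1,\dots,i_k}\partial_{i_1}\cdots\partial_{i_k}f(W(t_1),\dots,W(t_n))\prod_j 1[s_j\le t_{i_j}]$; $\mathbb D^{k,2}$ is the closure of these variables in the norm $\big(\sum_{j\le k}\|D^jF\|^2_{L^2(\Omega\times[0,T]^j)}\big)^{1/2}$, with $D^k$ extended to it, and $\mathbb D_\infty([0,T])=\bigcap_k\mathbb D^{k,2}$. For $F \in \mathbb D_\infty([0,T])$ and $0<t\le T$, $D^l_tF$ denotes the value of $D^l_{s_1,\dots,s_l}F$ at $s_1=\dots=s_l=t$, taken from the left, that is, the $L^2(\Omega)$-limit as $\varepsilon\downarrow0$ of the means of $D^l_{s_1,\dots,s_l}F$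 over $(s_1,\dots,s_l)\in(t-\varepsilon,t]^l$. Let $F\in\mathbb D_\infty([0,T])$ be measurable with respect to $\sigma\{W(\Delta),W(2\Delta),\dots,W(M\Delta)\}$, and suppose that $D^l_{(m+1)\Delta}F=0$ for all $l>L$. Then $D^l_{(m+1)\Delta}F$ exists for every $l\ge0$, and almost surely $$E[F\mid\mathcal F_{m\Delta}]=\sum_{l=0}^{L}\gamma(m,l)\,E\big[D^l_{(m+1)\Delta}F\,\big|\,\mathcal F_{(m+1)\Delta}\big],$$ where the random variables $\gamma(m,l)$ are given by $\gamma(m,0)=1$ and, for $l\ge1$, $$\gamma(m,l)=1\{l\text{ even}\}\Big(\frac{\Delta}{2}\Big)^{l/2}\frac1{(l/2)!}-\sum_{j=0}^{l-1}\gamma(m,j)\,\frac{\big(W((m+1)\Delta)-W(m\Delta)\big)^{l-j}}{(l-j)!}.$$ -/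

import Mathlib

open MeasureTheory ProbabilityTheory Filter Topology
open scoped NNReal ENNReal

namespace BackwardTaylor

variable {Ω : Type*}

/-- The data of a smooth cylindrical functional `f (W t₁, …, W tₙ)` with `tᵢ ∈ [0, T]` and
`f` smooth, `f` and all its derivatives having at most polynomial growth. -/
structure SmoothCylinder (T : ℝ≥0) where
  /-- the number of observation times -/
  n : ℕ
  /-- the observation times -/
  time : Fin n → ℝ≥0
  time_le : ∀ i, time i ≤ T
  /-- the function of the observed values -/
  f : (Fin n → ℝ) → ℝ
  temperate : f.HasTemperateGrowth

/-- The random variable `f (W t₁, …, W tₙ)`. -/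
def SmoothCylinder.eval {T : ℝ≥0} (S : SmoothCylinder T) (W : ℝ≥0 → Ω → ℝ) (ω : Ω) : ℝ :=
  S.f (fun i => W (S.time i) ω)

/-- The `k`-th Malliavin derivative of `f (W t₁, …, W tₙ)`,
`D_{s₁} ⋯ D_{s_k} F = ∑_{i₁, …, i_k} ∂_{i₁} ⋯ ∂_{i_k} f (W t₁, …, W tₙ) ∏ⱼ 1[sⱼ ≤ t_{iⱼ}]`,
that is, the `k`-th differential of `f` applied to the vectors `(1[sⱼ ≤ tᵢ])ᵢ`, `j = 1, …, k`. -/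
noncomputable def SmoothCylinder.deriv {T : ℝ≥0} (S : SmoothCylinder T) (W : ℝ≥0 → Ω → ℝ)
    (k : ℕ) (p : Ω × (Fin k → ℝ)) : ℝ :=
  iteratedFDeriv ℝ k S.f (fun i => W (S.time i) p.1)
    (fun j i => if p.2 j ≤ (S.time i : ℝ) then 1 else 0)

/-- The coefficients `γ(m, L)`, given by `γ(m, 0) = 1` and, for `L ≥ 1`, by
`γ(m, L) = 1[L even] (Δ/2)^(L/2) / (L/2)!
  - ∑_{l < L} γ(m, l) (W((m+1)Δ) - W(mΔ))^(L-l) / (L-l)!`. -/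
noncomputable def gamma (W : ℝ≥0 → Ω → ℝ) (Δ : ℝ≥0) (m : ℕ) (ω : Ω) : ℕ → ℝ
  | 0 => 1
  | L + 1 =>
    (if Even (L + 1) then ((Δ : ℝ) / 2) ^ ((L + 1) / 2) / (((L + 1) / 2).factorial : ℝ) else 0)
      - ∑ l : Fin (L + 1), gamma W Δ m ω l *
          (W ((m + 1) * Δ) ω - W (m * Δ) ω) ^ (L + 1 - (l : ℕ)) / ((L + 1 - (l : ℕ)).factorial : ℝ)

variable [MeasurableSpace Ω]

/-- The measure `P ⊗ Lebesgue` on `Ω × [0, T]^k`. -/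
noncomputable def timeProd (P : Measure Ω) (T : ℝ≥0) (k : ℕ) : Measure (Ω × (Fin k → ℝ)) :=
  P.prod (volume.restrict (Set.univ.pi fun _ => Set.Icc (0 : ℝ) T))

/-- `F` belongs to `𝔻^{k,2}` and its `k`-th Malliavin derivative is `U`: there is a sequence of
smooth cylindrical functionals that converges to `F` in `L²(Ω)`, whose derivatives of every order
`j ≤ k` converge in `L²(Ω × [0, T]^j)`, those of order `k` to `U`. -/
def HasMalliavinDeriv (W : ℝ≥0 → Ω → ℝ) (P : Measure Ω) (T : ℝ≥0) (F : Ω → ℝ) (k : ℕ)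
    (U : Ω × (Fin k → ℝ) → ℝ) : Prop :=
  MemLp F 2 P ∧
  ∃ (V : (j : ℕ) → Ω × (Fin j → ℝ) → ℝ) (S : ℕ → SmoothCylinder T),
    V k = U ∧
    Tendsto (fun n => eLpNorm (fun ω => (S n).eval W ω - F ω) 2 P) atTop (𝓝 0) ∧
    ∀ j ≤ k, MemLp (V j) 2 (timeProd P T j) ∧
      Tendsto (fun n => eLpNorm (fun p => (S n).deriv W j p - V j p) 2 (timeProd P T j))
        atTop (𝓝 0)

/-- `F` is infinitely Malliavin differentiable: it belongs to `𝔻^{k,2}` for every `k`. -/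
def MalliavinSmooth (W : ℝ≥0 → Ω → ℝ) (P : Measure Ω) (T : ℝ≥0) (F : Ω → ℝ) : Prop :=
  ∀ k : ℕ, ∃ U, HasMalliavinDeriv W P T F k U

/-- `G` is the Malliavin derivative `D_t^l F` of order `l` at the time `t`, that is, the value at
`(t, …, t)` of the `l`-th Malliavin derivative `U` of `F`. As `U` is a function of the times
`(s₁, …, s_l)` only up to null sets, its value at `(t, …, t)` is the left one: the limit in `L²(Ω)`,
as `ε ↓ 0`, of the means of `U` over `(t - ε, t]^l`. (For `F = f (W t₁, …, W tₙ)` this is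
`(∑_{i : t ≤ tᵢ} ∂ᵢ)^l f (W t₁, …, W tₙ)`.) -/
def HasMalliavinDerivAt (W : ℝ≥0 → Ω → ℝ) (P : Measure Ω) (T : ℝ≥0) (F : Ω → ℝ) (l : ℕ)
    (t : ℝ≥0) (G : Ω → ℝ) : Prop :=
  MemLp G 2 P ∧ ∃ U, HasMalliavinDeriv W P T F l U ∧
    Tendsto (fun ε : ℝ => eLpNorm
        (fun ω => (⨍ s in Set.univ.pi (fun _ : Fin l => Set.Ioc ((t : ℝ) - ε) t), U (ω, s)) - G ω)
        2 P)
      (𝓝[>] 0) (𝓝 0)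

end BackwardTaylor

/-! Let `X j = W ((j+1)Δ) - W (jΔ)`. As `W 0 = 0` almost surely, `F = φ(X)` with `X` a vector of
independent `N(0, Δ)` variables. For smooth `φ` the derivative of order `l` at `(m+1)Δ`, taken from
the left, is the partial derivative `∂ₘˡ φ(X)`. If that of order `L + 1` vanishes, `φ` is a
polynomial of degree at most `L` in its `m`-th variable, and Taylor's formula at the observed point,
`φ(X with y at m) = ∑ (y - Xₘ)ˡ / l! · ∂ₘˡ φ(X)`, is exact. Averaging over `y ~ N(0, Δ)` turns the
coefficients into `γ(m, l)`: by the binomial formula the centred moments satisfy the defining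
recursion (`gamma_eq_integral`). The averaged variable no longer depends on `Xₘ`, so its conditional
expectation at time `(m+1)Δ` is that of `F` at time `mΔ` (`condExp_integral_update`), and `γ(m, l)`,
a polynomial in `Xₘ`, comes out of the conditional expectation at time `(m+1)Δ`.

Three difficulties come from `F` being only an `L²` limit of cylindrical functionals, observed at
arbitrary times.

Reduction to the grid (`HasMalliavinDeriv.exists_isGridApprox`). Conditioning on `X` leaves `F`
unchanged and sends a cylindrical functional to a smooth function of `X`. The vector `(W tᵢ)` is its
regression on `X` plus an independent Gaussian residual, and the regression coefficients are the
means of `1[s ≤ tᵢ]` over the cells. Hence the partial derivatives of the projected function are the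
conditional expectations of the cell means of the Malliavin derivatives, and they converge as well.
Conversely, functions of `X` are cylindrical with derivatives constant on products of cells, which
yields the values at `(m+1)Δ` (`IsGridApprox.hasMalliavinDerivAt`).

Uniqueness (`HasMalliavinDerivAt.setIntegral_eq`). Gaussian integration by parts along one increment
expresses the means of any derivative `U` over `(u, t]^l`, tested against events of `σ(W)`, through
`F` alone. So two candidates for `D^l_t F` have the same conditional expectations given any part of
`σ(W)`.

Taylor's formula without pointwise derivatives (`ae_eq_taylor_of_tendsto`). It is applied to the
smooth approximants with a remainder controlled by an `L¹` norm of the derivative of order `L + 1`,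
which tends to `0`. -/

namespace BackwardTaylor

open scoped ContDiff

/-! ### Integration by parts and Taylor's formula on the line -/

section Calculus

variable {E : Type*} [NormedAddCommGroup E] [NormedSpace ℝ E]

theorem iteratedDeriv_comp_line {f : E → ℝ} (hf : ContDiff ℝ ∞ f) (a v : E) (l : ℕ) (y : ℝ) :
    iteratedDeriv l (fun y : ℝ => f (a + y • v)) y
      = iteratedFDeriv ℝ l f (a + y • v) (fun _ => v) := by
  have h1 : (fun y : ℝ => f (a + y • v))
      = (fun z => f (a + z)) ∘ (ContinuousLinearMap.toSpanSingleton ℝ v) := by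
    ext y; simp
  have hg : ContDiff ℝ ∞ (fun z => f (a + z)) := hf.comp (contDiff_const.add contDiff_id)
  rw [iteratedDeriv_eq_iteratedFDeriv, h1,
    ContinuousLinearMap.iteratedFDeriv_comp_right _ hg _ (by exact_mod_cast le_top),
    iteratedFDeriv_comp_add_left]
  simp

/-- Compact support of `χ` alone removes the boundary terms, so `u` may grow arbitrarily. -/
theorem integral_iteratedDeriv_mul {χ : ℝ → ℝ} (hχ : ContDiff ℝ ∞ χ) (hc : HasCompactSupport χ)
    (l : ℕ) {u : ℝ → ℝ} (hu : ContDiff ℝ ∞ u) :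
    ∫ y, iteratedDeriv l u y * χ y = (-1) ^ l * ∫ y, u y * iteratedDeriv l χ y := by
  induction l generalizing u with
  | zero => simp
  | succ l ih =>
    have hu' : ContDiff ℝ ∞ (deriv u) := ((contDiff_infty_iff_deriv (𝕜 := ℝ)).1 hu).2
    have hχl : ContDiff ℝ ∞ (iteratedDeriv l χ) := by
      rw [iteratedDeriv_eq_iterate]; exact hχ.iterate_deriv l
    have hcl : HasCompactSupport (iteratedDeriv l χ) := by
      rw [iteratedDeriv_eq_iterate]
      clear ih hχl
      induction l with
      | zero => simpa
      | succ n ihn => rw [Function.iterate_succ_apply']; exact ihn.deriv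
    have hχl' : ContDiff ℝ ∞ (deriv (iteratedDeriv l χ)) :=
      ((contDiff_infty_iff_deriv (𝕜 := ℝ)).1 hχl).2
    rw [iteratedDeriv_succ', ih hu', iteratedDeriv_succ, pow_succ, mul_assoc]
    congr 1
    have := integral_mul_deriv_eq_deriv_mul_of_integrable (u := u) (v := iteratedDeriv l χ)
      (u' := deriv u) (v' := deriv (iteratedDeriv l χ))
      (fun x _ => (hu.differentiable (by simp)).differentiableAt.hasDerivAt)
      (fun x _ => (hχl.differentiable (by simp)).differentiableAt.hasDerivAt)
      ((hu.continuous.mul hχl'.continuous).integrable_of_hasCompactSupport hcl.deriv.mul_left)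
      ((hu'.continuous.mul hχl.continuous).integrable_of_hasCompactSupport hcl.mul_left)
      ((hu.continuous.mul hχl.continuous).integrable_of_hasCompactSupport hcl.mul_left)
    simp [this]

/-- The integral form of the remainder, with `|y - s| ≤ 2N`. The bound uses an `L¹` norm of the
derivative over an interval independent of `x` and `y`, because only integral norms of the
derivatives will be known to converge. -/
theorem abs_sub_taylor_le {u : ℝ → ℝ} (hu : ContDiff ℝ ∞ u) (L : ℕ) {N x y : ℝ}
    (hx : |x| ≤ N) (hy : |y| ≤ N) :
    |u y - ∑ l ∈ Finset.range (L + 1), (y - x) ^ l / (l.factorial : ℝ) * iteratedDeriv l u x|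
      ≤ (2 * N) ^ L / (L.factorial : ℝ) * ∫ s in Set.Icc (-N) N, |iteratedDeriv (L + 1) u s| := by
  have hN : 0 ≤ N := (abs_nonneg x).trans hx
  have hcont : Continuous (iteratedDeriv (L + 1) u) := by
    rw [iteratedDeriv_eq_iterate]; exact (hu.iterate_deriv _).continuous
  have hint : IntegrableOn (fun s => |iteratedDeriv (L + 1) u s|) (Set.Icc (-N) N) :=
    hcont.abs.continuousOn.integrableOn_Icc
  have hnn : 0 ≤ (2 * N) ^ L / (L.factorial : ℝ) *
      ∫ s in Set.Icc (-N) N, |iteratedDeriv (L + 1) u s| := by positivity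
  -- For `x = y` the interval is a point, where derivatives within a set are not unique; there the
  -- Taylor sum is just `u x`.
  rcases eq_or_ne x y with rfl | hne
  · rw [Finset.sum_eq_single 0]
    · simpa using hnn
    · intro b _ hb; simp [hb]
    · simp
  have hU : UniqueDiffOn ℝ (Set.uIcc x y) := uniqueDiffOn_uIcc hne
  have hder : ∀ l, ∀ s ∈ Set.uIcc x y,
      iteratedDerivWithin l u (Set.uIcc x y) s = iteratedDeriv l u s := fun l s hs =>
    iteratedDerivWithin_eq_iteratedDeriv hU (hu.contDiffAt.of_le (by exact_mod_cast le_top)) hs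
  have hT := taylor_integral_remainder (n := L)
    (hu.contDiffOn (s := Set.uIcc x y) |>.of_le (by exact_mod_cast le_top))
  have hsum : taylorWithinEval u L (Set.uIcc x y) x y
      = ∑ l ∈ Finset.range (L + 1), (y - x) ^ l / (l.factorial : ℝ) * iteratedDeriv l u x := by
    rw [taylor_within_apply]
    refine Finset.sum_congr rfl fun l _ => ?_
    rw [hder l x Set.left_mem_uIcc, smul_eq_mul]; ring
  rw [hsum] at hT
  rw [hT, ← Real.norm_eq_abs]
  refine (intervalIntegral.norm_integral_le_integral_norm_uIoc).trans ?_
  rw [← integral_const_mul]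
  have hsub : Set.uIoc x y ⊆ Set.Icc (-N) N := fun s hs => by
    have h1 := abs_le.1 hx
    have h2 := abs_le.1 hy
    rcases Set.mem_uIoc.1 hs with h | h <;> constructor <;> linarith [h.1, h.2]
  calc _ ≤ ∫ s in Set.uIoc x y, (2 * N) ^ L / (L.factorial : ℝ) * |iteratedDeriv (L + 1) u s| := by
        refine integral_mono_of_nonneg (ae_of_all _ fun _ => norm_nonneg _)
          ((hint.mono_set hsub).const_mul _) ?_
        refine (ae_restrict_iff' measurableSet_uIoc).2 (ae_of_all _ fun s hs => ?_)
        have hs' := hsub hs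
        have h2 := abs_le.1 hy
        simp only
        rw [hder _ s (Set.uIoc_subset_uIcc hs), norm_smul, Real.norm_eq_abs, Real.norm_eq_abs,
          abs_div, abs_pow, Nat.abs_cast]
        gcongr
        exact abs_le.2 ⟨by linarith [hs'.2], by linarith [hs'.1]⟩
    _ ≤ _ := by
        refine setIntegral_mono_set (hint.const_mul _) (ae_of_all _ fun _ => ?_)
          hsub.eventuallyLE
        simp only [Pi.zero_apply]; positivity

end Calculus

/-! ### Averaging translates of a function of temperate growth -/

section TemperateAverage

variable {E : Type*} [NormedAddCommGroup E] [NormedSpace ℝ E] [FiniteDimensional ℝ E]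
  [MeasurableSpace E] [BorelSpace E]

/-- Separating `x` from `b` lets polynomial growth survive integration over `b`. -/
theorem one_add_norm_add_pow_le {E : Type*} [SeminormedAddCommGroup E] (x b : E) (k : ℕ) :
    (1 + ‖x + b‖) ^ k ≤ (1 + ‖x‖) ^ k * (1 + ‖b‖) ^ k := by
  rw [← mul_pow]
  gcongr
  nlinarith [norm_add_le x b, norm_nonneg x, norm_nonneg b]

theorem integral_linearIsometryEquiv_comp {α G H : Type*} [MeasurableSpace α] {μ : Measure α}
    [NormedAddCommGroup G] [NormedSpace ℝ G] [NormedAddCommGroup H] [NormedSpace ℝ H]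
    (e : G ≃ₗᵢ[ℝ] H) (g : α → G) : ∫ b, e (g b) ∂μ = e (∫ b, g b ∂μ) :=
  e.toContinuousLinearEquiv.integral_comp_comm g

theorem integrable_iteratedFDeriv_add {f : E → ℝ} (hf : f.HasTemperateGrowth)
    {μ : Measure E} [IsFiniteMeasure μ] (hμ : ∀ k : ℕ, Integrable (fun b => (1 + ‖b‖) ^ k) μ)
    (m : ℕ) (x : E) : Integrable (fun b => iteratedFDeriv ℝ m f (x + b)) μ := by
  obtain ⟨k, C, h⟩ := hf.2 m
  have hC : 0 ≤ C := by
    have := (norm_nonneg _).trans (h 0); simpa using this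
  refine Integrable.mono' ((hμ k).const_mul (C * (1 + ‖x‖) ^ k)) ?_ (ae_of_all _ fun b => ?_)
  · exact ((hf.1.continuous_iteratedFDeriv (by exact_mod_cast le_top)).comp
      (continuous_const.add continuous_id)).aestronglyMeasurable
  · refine (h _).trans ?_
    rw [mul_assoc]
    gcongr
    exact one_add_norm_add_pow_le x b k

/-- Differentiation under the integral, one order at a time: the integrals of the differentials of
`f` form a Taylor series, and hence are the differentials of the average at every order. -/
theorem hasFTaylorSeriesUpTo_average {f : E → ℝ} (hf : f.HasTemperateGrowth)
    {μ : Measure E} [IsFiniteMeasure μ] (hμ : ∀ k : ℕ, Integrable (fun b => (1 + ‖b‖) ^ k) μ) :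
    HasFTaylorSeriesUpTo ∞ (fun x => ∫ b, f (x + b) ∂μ)
      (fun x m => ∫ b, iteratedFDeriv ℝ m f (x + b) ∂μ) := by
  have key : ∀ (m : ℕ) (x : E), HasFDerivAt (fun y => ∫ b, iteratedFDeriv ℝ m f (y + b) ∂μ)
      (∫ b, iteratedFDeriv ℝ (m + 1) f (x + b) ∂μ).curryLeft x := by
    intro m x
    let e : (E [×(m + 1)]→L[ℝ] ℝ) ≃ₗᵢ[ℝ] (E →L[ℝ] (E [×m]→L[ℝ] ℝ)) :=
      continuousMultilinearCurryLeftEquiv ℝ (fun _ : Fin (m + 1) => E) ℝ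
    have hd : ∀ z, HasFDerivAt (iteratedFDeriv ℝ m f) (e (iteratedFDeriv ℝ (m + 1) f z)) z := by
      intro z
      have h1 := ((hf.1.differentiable_iteratedFDeriv (m := m)
        (by exact_mod_cast ENat.natCast_lt_top m)) z).hasFDerivAt
      convert h1 using 1
      rw [iteratedFDeriv_succ_eq_comp_left]
      simp [e]
    obtain ⟨k, C, h⟩ := hf.2 (m + 1)
    have hC : 0 ≤ C := by
      have := (norm_nonneg _).trans (h 0); simpa using this
    -- On the unit ball around `x` one has `1 + ‖y‖ ≤ 2 + ‖x‖`, whence the dominating function.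
    have := hasFDerivAt_integral_of_dominated_of_fderiv_le (μ := μ)
      (F := fun y b => iteratedFDeriv ℝ m f (y + b))
      (F' := fun y b => e (iteratedFDeriv ℝ (m + 1) f (y + b))) (x₀ := x)
      (s := Metric.ball x 1) (bound := fun b => (C * (2 + ‖x‖) ^ k) * (1 + ‖b‖) ^ k)
      (Metric.ball_mem_nhds x one_pos)
      (Eventually.of_forall fun y =>
        (integrable_iteratedFDeriv_add hf hμ m y).aestronglyMeasurable)
      (integrable_iteratedFDeriv_add hf hμ m x)
      (e.continuous.comp_aestronglyMeasurable
        (integrable_iteratedFDeriv_add hf hμ (m + 1) x).aestronglyMeasurable)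
      (ae_of_all _ fun b y hy => ?_) ((hμ k).const_mul _)
      (ae_of_all _ fun b y hy => ?_)
    · refine this.congr_fderiv ?_
      exact (integral_linearIsometryEquiv_comp (G := E [×(m + 1)]→L[ℝ] ℝ)
        (H := E →L[ℝ] (E [×m]→L[ℝ] ℝ)) (μ := μ) e
        (fun b => iteratedFDeriv ℝ (m + 1) f (x + b)))
    · rw [e.norm_map]
      refine (h _).trans ?_
      rw [mul_assoc]
      refine mul_le_mul_of_nonneg_left ((one_add_norm_add_pow_le y b k).trans ?_) hC
      have h1 : ‖y‖ ≤ ‖x‖ + 1 := by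
        have := norm_sub_norm_le y x
        have h2 : ‖y - x‖ < 1 := by simpa [dist_eq_norm] using hy
        linarith
      have h3 : 1 + ‖y‖ ≤ 2 + ‖x‖ := by linarith
      gcongr
    · exact (hasFDerivAt_comp_add_right b).2 (hd _)
  refine ⟨fun x => ?_, fun m _ x => key m x, fun m _ => ?_⟩
  · rw [ContinuousMultilinearMap.curry0_apply,
      ContinuousMultilinearMap.integral_apply (integrable_iteratedFDeriv_add hf hμ 0 x)]
    simp
  · exact continuous_iff_continuousAt.2 fun x => (key m x).continuousAt

theorem hasTemperateGrowth_average {f : E → ℝ} (hf : f.HasTemperateGrowth)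
    {μ : Measure E} [IsFiniteMeasure μ] (hμ : ∀ k : ℕ, Integrable (fun b => (1 + ‖b‖) ^ k) μ) :
    (fun x => ∫ b, f (x + b) ∂μ).HasTemperateGrowth := by
  have hT := hasFTaylorSeriesUpTo_average hf hμ
  refine ⟨hT.contDiff, fun n => ?_⟩
  obtain ⟨k, C, h⟩ := hf.2 n
  refine ⟨k, C * ∫ b, (1 + ‖b‖) ^ k ∂μ, fun x => ?_⟩
  rw [← hT.eq_iteratedFDeriv (by exact_mod_cast le_top)]
  have hC : 0 ≤ C := by
    have := (norm_nonneg _).trans (h 0); simpa using this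
  calc _ ≤ ∫ b, C * (1 + ‖x‖) ^ k * (1 + ‖b‖) ^ k ∂μ := by
        refine norm_integral_le_of_norm_le ((hμ k).const_mul _) (ae_of_all _ fun b => ?_)
        refine (h _).trans ?_
        rw [mul_assoc]
        exact mul_le_mul_of_nonneg_left (one_add_norm_add_pow_le x b k) hC
    _ = _ := by rw [integral_const_mul]; ring

theorem iteratedFDeriv_average_apply {f : E → ℝ} (hf : f.HasTemperateGrowth)
    {μ : Measure E} [IsFiniteMeasure μ] (hμ : ∀ k : ℕ, Integrable (fun b => (1 + ‖b‖) ^ k) μ)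
    (m : ℕ) (x : E) (v : Fin m → E) :
    iteratedFDeriv ℝ m (fun x => ∫ b, f (x + b) ∂μ) x v
      = ∫ b, iteratedFDeriv ℝ m f (x + b) v ∂μ := by
  rw [← (hasFTaylorSeriesUpTo_average hf hμ).eq_iteratedFDeriv (by exact_mod_cast le_top),
    ContinuousMultilinearMap.integral_apply (integrable_iteratedFDeriv_add hf hμ m x)]

end TemperateAverage

end BackwardTaylor

namespace BackwardTaylor

/-! ### Conditioning on independent variables, and tests for vanishing integrals -/

section Probability

theorem map_prodMk_of_indep {Ω α β : Type*} [MeasurableSpace α] [MeasurableSpace β]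
    {m mΩ : MeasurableSpace Ω} {P : Measure Ω} [IsProbabilityMeasure P] (hm : m ≤ mΩ) {V : Ω → α}
    {Z : Ω → β} (hV : Measurable[m] V) (hZ : Measurable Z)
    (hind : Indep m (MeasurableSpace.comap Z inferInstance) P) :
    P.map (fun ω => (V ω, Z ω)) = (P.map V).prod (P.map Z) :=
  (indepFun_iff_map_prod_eq_prod_map_map (hV.mono hm le_rfl).aemeasurable hZ.aemeasurable).1
    (indep_of_indep_of_le_left hind hV.comap_le)

/-- The freezing lemma: in a conditional expectation, an argument that is measurable is kept, and
one that is independent of the conditioning is integrated out. -/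
theorem condExp_comp_prodMk_of_indep {Ω α β : Type*} [MeasurableSpace α] [MeasurableSpace β]
    {m mΩ : MeasurableSpace Ω} {P : Measure Ω} [IsProbabilityMeasure P] (hm : m ≤ mΩ) {V : Ω → α} {Z : Ω → β}
    (hV : Measurable[m] V) (hZ : Measurable Z)
    (hind : Indep m (MeasurableSpace.comap Z inferInstance) P) {g : α × β → ℝ} (hg : Measurable g)
    (hint : Integrable (fun ω => g (V ω, Z ω)) P) :
    P[fun ω => g (V ω, Z ω) | m] =ᵐ[P] fun ω => ∫ z, g (V ω, z) ∂(P.map Z) := by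
  have : IsProbabilityMeasure (P.map Z) := Measure.isProbabilityMeasure_map hZ.aemeasurable
  have hgs : StronglyMeasurable fun v => ∫ z, g (v, z) ∂(P.map Z) :=
    hg.stronglyMeasurable.integral_prod_right'
  have hVm : Measurable V := hV.mono hm le_rfl
  have hint2 : Integrable g ((P.map V).prod (P.map Z)) := by
    rw [← map_prodMk_of_indep hm hV hZ hind, integrable_map_measure hg.aestronglyMeasurable (hVm.prodMk hZ).aemeasurable]
    exact hint
  have hint3 : Integrable (fun ω => ∫ z, g (V ω, z) ∂(P.map Z)) P :=
    (integrable_map_measure hgs.aestronglyMeasurable hVm.aemeasurable).1 hint2.integral_prod_left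
  symm
  refine ae_eq_condExp_of_forall_setIntegral_eq hm hint (fun A _ _ => hint3.integrableOn)
    (fun A hA _ => ?_) (hgs.measurable.comp hV).stronglyMeasurable.aestronglyMeasurable
  -- The indicator of `A` is joined to `V`: the pair is still `m`-measurable, hence independent of
  -- `Z`, and the integral over `A` becomes one against a product law.
  have hV' : Measurable[m] fun ω => (A.indicator (fun _ => (1 : ℝ)) ω, V ω) :=
    (measurable_const.indicator hA).prodMk hV
  have hV'm := hV'.mono hm le_rfl
  have hA' := hm A hA
  have hl := map_prodMk_of_indep hm hV' hZ hind
  have hg' : Measurable fun p : (ℝ × α) × β => p.1.1 * g (p.1.2, p.2) := by fun_prop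
  have hind' : ∀ (k : Ω → ℝ), (∫ ω in A, k ω ∂P)
      = ∫ ω, A.indicator (fun _ => (1 : ℝ)) ω * k ω ∂P := fun k => by
    rw [← integral_indicator hA']
    refine integral_congr_ae (ae_of_all _ fun ω => ?_)
    by_cases h : ω ∈ A <;> simp [h]
  rw [hind', hind']
  have h1 : Integrable (fun p : (ℝ × α) × β => p.1.1 * g (p.1.2, p.2))
      ((P.map fun ω => (A.indicator (fun _ => (1 : ℝ)) ω, V ω)).prod (P.map Z)) := by
    rw [← hl, integrable_map_measure hg'.aestronglyMeasurable (hV'm.prodMk hZ).aemeasurable]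
    refine hint.bdd_mul (c := 1) (measurable_const.indicator hA').aestronglyMeasurable
      (ae_of_all _ fun ω => ?_)
    by_cases h : ω ∈ A <;> simp [h]
  calc _ = ∫ ω, (∫ z, A.indicator (fun _ => (1 : ℝ)) ω * g (V ω, z) ∂(P.map Z)) ∂P := by
        simp_rw [integral_const_mul]
    _ = ∫ v, (∫ z, v.1 * g (v.2, z) ∂(P.map Z))
          ∂(P.map fun ω => (A.indicator (fun _ => (1 : ℝ)) ω, V ω)) := by
        rw [integral_map hV'm.aemeasurable
          (hg'.stronglyMeasurable.integral_prod_right').aestronglyMeasurable]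
    _ = ∫ p, p.1.1 * g (p.1.2, p.2) ∂(P.map fun ω =>
          ((A.indicator (fun _ => (1 : ℝ)) ω, V ω), Z ω)) := by
        rw [hl, integral_prod _ h1]
    _ = _ := by
        rw [integral_map (hV'm.prodMk hZ).aemeasurable hg'.aestronglyMeasurable]

variable {Ω : Type*} {mΩ : MeasurableSpace Ω} {P : Measure Ω}

theorem eLpNorm_two_eq_lintegral {α : Type*} [MeasurableSpace α] (μ : Measure α) (f : α → ℝ) :
    eLpNorm f 2 μ = (∫⁻ x, ‖f x‖ₑ ^ (2 : ℝ) ∂μ) ^ (1 / 2 : ℝ) := by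
  rw [eLpNorm_eq_lintegral_rpow_enorm_toReal (by simp) (by simp)]
  simp

/-- Jensen's inequality in `s`: averaging over the times is a contraction of `L²`, so that
convergence of Malliavin derivatives passes to their means. -/
theorem eLpNorm_integral_prod_le {S : Type*} [MeasurableSpace S] {κ : Measure S}
    [IsProbabilityMeasure P] [IsProbabilityMeasure κ] {U : Ω × S → ℝ}
    (hU : AEStronglyMeasurable U (P.prod κ)) :
    eLpNorm (fun ω => ∫ s, U (ω, s) ∂κ) 2 P ≤ eLpNorm U 2 (P.prod κ) := by
  rw [eLpNorm_two_eq_lintegral, eLpNorm_two_eq_lintegral, lintegral_prod _ (hU.enorm.pow_const _)]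
  gcongr ?_ ^ (1 / 2 : ℝ)
  refine lintegral_mono_ae ?_
  filter_upwards [hU.prodMk_left] with ω hω
  have h1 : ‖∫ s, U (ω, s) ∂κ‖ₑ ≤ eLpNorm (fun s => U (ω, s)) 2 κ :=
    (enorm_integral_le_lintegral_enorm _).trans
      (eLpNorm_one_eq_lintegral_enorm.symm.le.trans
        (eLpNorm_le_eLpNorm_of_exponent_le (by norm_num) hω))
  calc _ ≤ (eLpNorm (fun s => U (ω, s)) 2 κ) ^ (2 : ℝ) := by gcongr
    _ = _ := by
      rw [eLpNorm_two_eq_lintegral, ← ENNReal.rpow_mul]; norm_num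

/-- The conditional expectation of `1_A H` given `Y` is some `k(Y)`. By hypothesis `k` is orthogonal
to all test functions under the law of `Y`, so it vanishes almost everywhere. -/
theorem setIntegral_preimage_eq_zero_of_contDiff [IsFiniteMeasure P] {H : Ω → ℝ}
    (hH : Integrable H P) {Y : Ω → ℝ} (hY : Measurable Y) {A : Set Ω} (hA : MeasurableSet A)
    (h : ∀ φ : ℝ → ℝ, ContDiff ℝ (⊤ : ℕ∞) φ → HasCompactSupport φ → ∫ ω in A, H ω * φ (Y ω) ∂P = 0)
    {B : Set ℝ} (hB : MeasurableSet B) : ∫ ω in A ∩ Y ⁻¹' B, H ω ∂P = 0 := by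
  have hm : MeasurableSpace.comap Y inferInstance ≤ mΩ := hY.comap_le
  have hHA : Integrable (A.indicator H) P := hH.indicator hA
  obtain ⟨k, hk, hke⟩ := (stronglyMeasurable_condExp (f := A.indicator H) (m := MeasurableSpace.comap Y inferInstance)
    (μ := P)).exists_eq_measurable_comp
  have hki : Integrable k (P.map Y) := by
    rw [integrable_map_measure hk.aestronglyMeasurable hY.aemeasurable, ← hke]
    exact integrable_condExp
  have h0 : k =ᵐ[P.map Y] 0 := by
    refine ae_eq_zero_of_integral_contDiff_smul_eq_zero hki.locallyIntegrable fun φ hφ hc => ?_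
    have hφm : Measurable φ := hφ.continuous.measurable
    obtain ⟨c, hcb⟩ := hφ.continuous.bounded_above_of_compact_support hc
    have hi : Integrable (A.indicator H * fun ω => φ (Y ω)) P :=
      hHA.mul_bdd (c := c) (hφm.comp hY).aestronglyMeasurable (ae_of_all _ fun ω => hcb _)
    rw [integral_map hY.aemeasurable (f := fun y => φ y • k y)
      (hφm.smul hk.measurable).aestronglyMeasurable]
    have h2 : P[A.indicator H * fun ω => φ (Y ω) | MeasurableSpace.comap Y inferInstance] =ᵐ[P] fun ω => φ (Y ω) • k (Y ω) := by
      have := condExp_mul_of_stronglyMeasurable_right (m := MeasurableSpace.comap Y inferInstance) (μ := P) (f := A.indicator H)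
        (g := fun ω => φ (Y ω))
        (hφm.comp (comap_measurable Y)).stronglyMeasurable hi hHA
      refine this.trans (ae_of_all _ fun ω => ?_)
      simp only [Pi.mul_apply, hke, Function.comp, smul_eq_mul, mul_comm]
    rw [← integral_congr_ae h2, integral_condExp hm, ← h φ hφ hc, ← integral_indicator hA]
    refine integral_congr_ae (ae_of_all _ fun ω => ?_)
    by_cases hω : ω ∈ A <;> simp [hω]
  have h1 : P[A.indicator H | MeasurableSpace.comap Y inferInstance] =ᵐ[P] 0 := by
    rw [hke]
    exact ae_of_ae_map hY.aemeasurable h0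
  have h2 : ∫ ω in Y ⁻¹' B, A.indicator H ω ∂P = 0 := by
    rw [← setIntegral_condExp hm hHA ⟨B, hB, rfl⟩, setIntegral_congr_ae (g := fun _ => 0) (hY hB)
      (h1.mono fun ω hω _ => hω)]
    simp
  rw [Set.inter_comm, ← h2, setIntegral_indicator hA]

/-- Rectangles form a π-system generating the product σ-algebra. -/
theorem setIntegral_eq_zero_of_prodMk {S : Type*} [MeasurableSpace S] {H : Ω → ℝ}
    (hH : Integrable H P) {R : Ω → S} {Y : Ω → ℝ} (hR : Measurable R) (hY : Measurable Y)
    (h : ∀ A B, MeasurableSet A → MeasurableSet B → ∫ ω in R ⁻¹' A ∩ Y ⁻¹' B, H ω ∂P = 0)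
    {D : Set (S × ℝ)} (hD : MeasurableSet D) :
    ∫ ω in (fun ω => (R ω, Y ω)) ⁻¹' D, H ω ∂P = 0 := by
  have hRY : Measurable fun ω => (R ω, Y ω) := hR.prodMk hY
  have huniv : ∫ ω, H ω ∂P = 0 := by
    simpa using h Set.univ Set.univ MeasurableSet.univ MeasurableSet.univ
  induction D, hD using MeasurableSpace.induction_on_inter generateFrom_prod.symm
    isPiSystem_prod with
  | empty => simp
  | basic t ht =>
    obtain ⟨A, hA, B, hB, rfl⟩ := ht
    exact h A B hA hB
  | compl t ht ih =>
    rw [Set.preimage_compl, setIntegral_compl (hRY ht) hH, ih, huniv, sub_zero]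
  | iUnion f hd hf ih =>
    rw [Set.preimage_iUnion, integral_iUnion (fun i => hRY (hf i))
      (fun i j hij => (hd hij).preimage _) hH.integrableOn]
    simp [ih]

end Probability

/-! ### Gaussian moments and the coefficients `γ(m, l)` -/

section Moments

theorem integrable_pow_gaussianReal (v : ℝ≥0) (n : ℕ) :
    Integrable (fun y : ℝ => y ^ n) (gaussianReal 0 v) := by
  have := (memLp_id_gaussianReal (μ := 0) (v := v) n).integrable_norm_pow'
  refine this.mono' (by fun_prop) (ae_of_all _ fun y => ?_)
  simp

theorem hasDerivAt_gaussianPDFReal (v : ℝ≥0) (x : ℝ) :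
    HasDerivAt (gaussianPDFReal 0 v) (-(x / v) * gaussianPDFReal 0 v x) x := by
  rw [gaussianPDFReal_def]
  have h : HasDerivAt (fun x : ℝ => -(x - 0) ^ 2 / (2 * v)) (-(x / v)) x := by
    have := (((hasDerivAt_id x).sub_const 0).pow 2).neg.div_const (2 * (v : ℝ))
    refine this.congr_deriv ?_
    rcases eq_or_ne (v : ℝ) 0 with h | h
    · simp [h]
    · simp; field_simp
  refine (h.exp.const_mul _).congr_deriv ?_
  ring

/-- Integration by parts against the density `p`, using `p'(x) = -(x / v) p(x)`. -/
theorem integral_pow_add_two_gaussianReal {v : ℝ≥0} (hv : v ≠ 0) (n : ℕ) :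
    ∫ y, y ^ (n + 2) ∂(gaussianReal 0 v) = (n + 1) * v * ∫ y, y ^ n ∂(gaussianReal 0 v) := by
  have hi : ∀ k : ℕ, Integrable fun y : ℝ => y ^ k * gaussianPDFReal 0 v y := fun k => by
    have := integrable_pow_gaussianReal v k
    rw [gaussianReal_of_var_ne_zero _ hv, integrable_withDensity_iff_integrable_smul'
      (measurable_gaussianPDF 0 v) (ae_of_all _ fun _ => gaussianPDF_lt_top)] at this
    simpa [toReal_gaussianPDF, mul_comm] using this
  have hv' : (v : ℝ) ≠ 0 := by exact_mod_cast hv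
  have := integral_mul_deriv_eq_deriv_mul_of_integrable (u := fun y : ℝ => y ^ (n + 1))
    (v := gaussianPDFReal 0 v) (u' := fun y => ((n + 1 : ℕ) : ℝ) * y ^ n)
    (v' := fun x => -(x / v) * gaussianPDFReal 0 v x)
    (fun x _ => by simpa using hasDerivAt_pow (n + 1) x)
    (fun x _ => hasDerivAt_gaussianPDFReal v x)
    (((hi (n + 2)).const_mul (-(1 / (v : ℝ)))).congr (ae_of_all _ fun y => by
      simp only [Pi.mul_apply]; ring))
    (((hi n).const_mul (n + 1)).congr (ae_of_all _ fun y => by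
      simp only [Pi.mul_apply]; push_cast; ring)) (hi (n + 1))
  have e1 : (fun x : ℝ => x ^ (n + 1) * (-(x / v) * gaussianPDFReal 0 v x))
      = fun x => -(1 / (v : ℝ)) * (gaussianPDFReal 0 v x • x ^ (n + 2)) := by
    ext x; simp only [smul_eq_mul]; ring
  have e2 : (fun x : ℝ => ((n + 1 : ℕ) : ℝ) * x ^ n * gaussianPDFReal 0 v x)
      = fun x => ((n + 1 : ℕ) : ℝ) * (gaussianPDFReal 0 v x • x ^ n) := by
    ext x; simp only [smul_eq_mul]; ring
  rw [e1, e2, integral_const_mul, integral_const_mul,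
    ← integral_gaussianReal_eq_integral_smul hv, ← integral_gaussianReal_eq_integral_smul hv] at this
  field_simp at this
  push_cast at this
  linarith

theorem integral_pow_div_factorial_gaussianReal {v : ℝ≥0} (hv : v ≠ 0) (n : ℕ) :
    (∫ y, y ^ n ∂(gaussianReal 0 v)) / (n.factorial : ℝ)
      = if Even n then ((v : ℝ) / 2) ^ (n / 2) / ((n / 2).factorial : ℝ) else 0 := by
  induction n using Nat.twoStepInduction with
  | zero => simp
  | one => simp [integral_id_gaussianReal]
  | more n ih _ =>
    rw [integral_pow_add_two_gaussianReal hv, Nat.factorial_succ, Nat.factorial_succ]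
    have h1 : ((n + 1 : ℝ) * v * ∫ y, y ^ n ∂(gaussianReal 0 v)) /
        (((n + 1 + 1) * ((n + 1) * n.factorial) : ℕ) : ℝ)
        = v / (n + 2) * ((∫ y, y ^ n ∂(gaussianReal 0 v)) / (n.factorial : ℝ)) := by
      push_cast
      have : (n.factorial : ℝ) ≠ 0 := by positivity
      field_simp
      ring
    rw [h1, ih]
    by_cases hn : Even n
    · obtain ⟨k, rfl⟩ := hn
      have h2 : Even (k + k + 2) := ⟨k + 1, by ring⟩
      have h3 : (k + k + 2) / 2 = k + 1 := by omega
      have h4 : (k + k) / 2 = k := by omega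
      rw [if_pos ⟨k, rfl⟩, if_pos h2, h3, h4, Nat.factorial_succ]
      have : (k.factorial : ℝ) ≠ 0 := by positivity
      push_cast
      field_simp
      ring
    · have : ¬ Even (n + 2) := by simpa [Nat.even_add] using hn
      simp [hn, this]

theorem integrable_sub_pow_gaussianReal (v : ℝ≥0) (x : ℝ) (n : ℕ) :
    Integrable (fun y : ℝ => (y - x) ^ n) (gaussianReal 0 v) := by
  simp_rw [sub_eq_add_neg, add_pow]
  exact integrable_finsetSum _ fun i _ =>
    ((integrable_pow_gaussianReal v i).mul_const _).mul_const _

/-- `γ(m, l)` is the normalized `l`-th moment of the Brownian increment, centred at its observed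
value. -/
theorem gamma_eq_integral {Ω : Type*} (W : ℝ≥0 → Ω → ℝ) {Δ : ℝ≥0} (hΔ : Δ ≠ 0) (m : ℕ) (ω : Ω)
    (l : ℕ) : gamma W Δ m ω l = (∫ y, (y - (W ((m + 1) * Δ) ω - W (m * Δ) ω)) ^ l
      ∂(gaussianReal 0 Δ)) / (l.factorial : ℝ) := by
  set x := W ((m + 1) * Δ) ω - W (m * Δ) ω with hx
  induction l using Nat.strong_induction_on with
  | _ l ih =>
    cases l with
    | zero => simp [gamma]
    | succ L =>
      rw [gamma, ← integral_pow_div_factorial_gaussianReal hΔ]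
      simp only [← hx]
      -- Expansion of `y = (y - x) + x`: the term `j = L + 1` is the centred moment sought, and the
      -- lower ones are the sum subtracted in the recursion for `γ`.
      have hexp : ∀ y : ℝ, y ^ (L + 1) = ∑ j ∈ Finset.range (L + 1 + 1),
          (y - x) ^ j * x ^ (L + 1 - j) * ((L + 1).choose j : ℝ) := fun y => by
        rw [← add_pow]; ring
      rw [integral_congr_ae (f := fun y => y ^ (L + 1)) (ae_of_all _ hexp), integral_finsetSum _ fun j _ =>
        ((integrable_sub_pow_gaussianReal Δ x j).mul_const _).mul_const _]
      simp_rw [integral_mul_const]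
      rw [Finset.sum_range_succ, Finset.sum_range, add_div, Finset.sum_div]
      have : ∀ l : Fin (L + 1), gamma W Δ m ω l * x ^ (L + 1 - (l : ℕ)) /
            ((L + 1 - (l : ℕ)).factorial : ℝ)
          = (∫ y, (y - x) ^ (l : ℕ) ∂(gaussianReal 0 Δ)) * x ^ (L + 1 - (l : ℕ))
            * ((L + 1).choose l : ℝ) / ((L + 1).factorial : ℝ) := fun l => by
        rw [ih l l.2, Nat.cast_choose ℝ l.2.le]
        have h1 : ((l : ℕ).factorial : ℝ) ≠ 0 := by positivity
        have h2 : ((L + 1 - (l : ℕ)).factorial : ℝ) ≠ 0 := by positivity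
        have h3 : ((L + 1).factorial : ℝ) ≠ 0 := by positivity
        field_simp
      simp_rw [this]
      simp

end Moments

end BackwardTaylor

namespace BackwardTaylor

/-! ### Regression of Brownian motion on increments -/

section Brownian

variable {Ω : Type*} [MeasurableSpace Ω] {P : Measure Ω} {W : ℝ≥0 → Ω → ℝ}

theorem exists_eq_clm_restrict_of_mem_span {Ω T : Type*} {X : T → Ω → ℝ} {Z : Ω → ℝ}
    (hZ : Z ∈ Submodule.span ℝ (Set.range X)) :
    ∃ I : Finset T, ∃ L : (I → ℝ) →L[ℝ] ℝ, ∀ ω, Z ω = L (I.restrict (X · ω)) := by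
  obtain ⟨c, rfl⟩ := Finsupp.mem_span_range_iff_exists_finsupp.1 hZ
  refine ⟨c.support, ∑ i : c.support, c i • ContinuousLinearMap.proj i, fun ω => ?_⟩
  rw [Finsupp.sum, ← Finset.sum_coe_sort]
  simp [Finset.sum_apply]

theorem isGaussianProcess_of_mem_span {S T : Type*} {X : T → Ω → ℝ} (hX : IsGaussianProcess X P)
    {Z : S → Ω → ℝ} (hZ : ∀ s, Z s ∈ Submodule.span ℝ (Set.range X)) : IsGaussianProcess Z P :=
  hX.of_isGaussianProcess fun s => exists_eq_clm_restrict_of_mem_span (hZ s)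

theorem IsGaussianProcess.hasGaussianLaw_pi {S : Type*} [Fintype S] {Z : S → Ω → ℝ}
    (hZ : IsGaussianProcess Z P) : HasGaussianLaw (fun ω s => Z s ω) P := by
  let L : (↥(Finset.univ : Finset S) → ℝ) →L[ℝ] (S → ℝ) :=
    ContinuousLinearMap.pi fun s =>
      ContinuousLinearMap.proj (⟨s, Finset.mem_univ s⟩ : ↥(Finset.univ : Finset S))
  exact (hZ.hasGaussianLaw Finset.univ).map L

theorem HasGaussianLaw.integrable_one_add_norm_pow {E : Type*} [NormedAddCommGroup E]
    [NormedSpace ℝ E] [CompleteSpace E] [SecondCountableTopology E] [MeasurableSpace E]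
    [BorelSpace E] {Z : Ω → E} (hZ : HasGaussianLaw Z P) (k : ℕ) :
    Integrable (fun ω => (1 + ‖Z ω‖) ^ k) P := by
  have := hZ.isProbabilityMeasure
  have h0 : MemLp Z k P := hZ.memLp (by simp)
  have h1 : MemLp (fun ω => (1 : ℝ) + ‖Z ω‖) k P := (memLp_const (1 : ℝ)).add h0.norm
  have h2 := h1.integrable_norm_pow'
  refine h2.congr (ae_of_all _ fun ω => ?_)
  change ‖1 + ‖Z ω‖‖ ^ k = _
  rw [Real.norm_of_nonneg (by positivity)]

/-- The mean of `s ↦ 1[s ≤ t]` over the interval `(a, b]`. -/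
noncomputable def ramp (a b t : ℝ) : ℝ := (min b t - min a t) / (b - a)

/-- What is left of `W s` when its regression on the increments of `W` over the intervals
`(a β, b β]` is subtracted. -/
noncomputable def residual {ι : Type*} [Fintype ι] (W : ℝ≥0 → Ω → ℝ) (a b : ι → ℝ≥0) (s : ℝ≥0)
    (ω : Ω) : ℝ :=
  W s ω - ∑ β, ramp (a β) (b β) s * (W (b β) ω - W (a β) ω)

variable {ι : Type*} [Fintype ι] {a b : ι → ℝ≥0}

theorem residual_mem_span {Ω ι : Type*} [Fintype ι] {W : ℝ≥0 → Ω → ℝ} (a b : ι → ℝ≥0) (s : ℝ≥0) :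
    residual W a b s ∈ Submodule.span ℝ (Set.range W) := by
  have : residual W a b s = W s - ∑ β, ramp (a β) (b β) s • (W (b β) - W (a β)) := by
    ext ω; simp [residual]
  rw [this]
  have hw : ∀ t, W t ∈ Submodule.span ℝ (Set.range W) := fun t => Submodule.subset_span ⟨t, rfl⟩
  exact Submodule.sub_mem _ (hw s) (Submodule.sum_mem _ fun β _ =>
    Submodule.smul_mem _ _ (Submodule.sub_mem _ (hw _) (hw _)))

theorem IsPreBrownianReal.memLp_two (hW : IsPreBrownianReal W P) (t : ℝ≥0) : MemLp (W t) 2 P :=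
  (hW.isGaussianProcess.hasGaussianLaw_eval t).memLp_two

theorem covariance_sub_increment (hW : IsPreBrownianReal W P) (s u v : ℝ≥0) :
    cov[W s, fun ω => W v ω - W u ω; P] = min (v : ℝ) s - min (u : ℝ) s := by
  have := hW.isGaussianProcess.isProbabilityMeasure
  have h := IsPreBrownianReal.memLp_two hW
  rw [covariance_fun_sub_right (h s) (h v) (h u), hW.covariance_eval, hW.covariance_eval]
  simp [min_comm]

/-- Residuals and increments are jointly Gaussian, so zero covariance suffices. Increments over
disjoint intervals are uncorrelated, and `ramp` is the regression coefficient: the covariance of `W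
s` with the increment divided by the variance `b - a`. -/
theorem indepFun_residual (hW : IsPreBrownianReal W P) (hab : ∀ β, a β < b β)
    (hd : ∀ β γ, β ≠ γ → b β ≤ a γ ∨ b γ ≤ a β) :
    IndepFun (fun ω s => residual W a b s ω) (fun ω β => W (b β) ω - W (a β) ω) P := by
  classical
  have hP := hW.isGaussianProcess.isProbabilityMeasure
  have hw : ∀ t, W t ∈ Submodule.span ℝ (Set.range W) := fun t => Submodule.subset_span ⟨t, rfl⟩
  have h2 := IsPreBrownianReal.memLp_two hW
  have hspan : ∀ i, Sum.elim (residual W a b) (fun β => W (b β) - W (a β)) i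
      ∈ Submodule.span ℝ (Set.range W) := by
    rintro (s | β)
    · exact residual_mem_span a b s
    · exact Submodule.sub_mem _ (hw _) (hw _)
  have hG := isGaussianProcess_of_mem_span hW.isGaussianProcess hspan
  refine IsGaussianProcess.indepFun_of_covariance_eq_zero (Y := fun β => W (b β) - W (a β)) hG
    (fun s => hG.aemeasurable (Sum.inl s)) (fun β => hG.aemeasurable (Sum.inr β)) fun s β => ?_
  have hX : ∀ β, MemLp (fun ω => W (b β) ω - W (a β) ω) 2 P := fun β => (h2 _).sub (h2 _)
  have e1 : cov[residual W a b s, W (b β) - W (a β); P]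
      = cov[fun ω => W s ω - (∑ γ, ramp (a γ) (b γ) s * (W (b γ) ω - W (a γ) ω)),
        fun ω => W (b β) ω - W (a β) ω; P] := rfl
  rw [e1, covariance_fun_sub_left (h2 s) (memLp_finsetSum _ fun γ _ => (hX γ).const_mul _) (hX β),
    covariance_fun_sum_left (fun γ => (hX γ).const_mul _) (hX β), Finset.sum_eq_single β]
  · have hne : (b β : ℝ) - a β ≠ 0 := sub_ne_zero.2 (by exact_mod_cast (hab β).ne')
    have hle : (a β : ℝ) ≤ b β := by exact_mod_cast (hab β).le
    rw [covariance_const_mul_left, covariance_fun_sub_left (h2 _) (h2 _) (hX β),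
      covariance_sub_increment hW, covariance_sub_increment hW, covariance_sub_increment hW, ramp]
    simp only [min_self, min_eq_left hle, min_eq_right hle]
    field_simp
    ring
  · intro γ _ hγ
    rw [covariance_const_mul_left, covariance_fun_sub_left (h2 _) (h2 _) (hX β),
      covariance_sub_increment hW, covariance_sub_increment hW]
    have h3 : (a β : ℝ) ≤ b β := by exact_mod_cast (hab β).le
    have h4 : (a γ : ℝ) ≤ b γ := by exact_mod_cast (hab γ).le
    rcases hd γ β hγ with h | h
    · have h5 : (b γ : ℝ) ≤ a β := by exact_mod_cast h
      rw [min_eq_right (h5.trans h3), min_eq_right h5, min_eq_right (h4.trans (h5.trans h3)),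
        min_eq_right (h4.trans h5)]
      ring
    · have h5 : (b β : ℝ) ≤ a γ := by exact_mod_cast h
      rw [min_eq_left (h5.trans h4), min_eq_left (h3.trans (h5.trans h4)), min_eq_left h5,
        min_eq_left (h3.trans h5)]
      ring
  · simp

theorem map_sub_eq_gaussianReal (hW : IsPreBrownianReal W P) {s t : ℝ≥0} (h : s ≤ t) :
    P.map (fun ω => W t ω - W s ω) = gaussianReal 0 (t - s) := by
  have h1 := (hW.hasLaw_sub t s).map_eq
  have h2 : nndist (t : ℝ) (s : ℝ) = t - s := by
    ext
    rw [coe_nndist, Real.dist_eq, NNReal.coe_sub h,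
      abs_of_nonneg (sub_nonneg.2 (by exact_mod_cast h))]
  rw [← h2]
  exact h1

/-- The increments of `W` over the cells `(jΔ, (j + 1)Δ]` of the grid. -/
noncomputable def gridIncr (W : ℝ≥0 → Ω → ℝ) (Δ : ℝ≥0) (M : ℕ) (ω : Ω) (j : Fin M) : ℝ :=
  W (((j : ℕ) + 1) * Δ) ω - W ((j : ℕ) * Δ) ω

theorem measurable_gridIncr (hWm : ∀ t, Measurable (W t)) (Δ : ℝ≥0) (M : ℕ) :
    Measurable (gridIncr W Δ M) :=
  measurable_pi_lambda _ fun _ => (hWm _).sub (hWm _)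

theorem map_gridIncr (hW : IsPreBrownianReal W P) (hWm : ∀ t, Measurable (W t)) (Δ : ℝ≥0) (M : ℕ) :
    P.map (gridIncr W Δ M) = Measure.pi fun _ => gaussianReal 0 Δ := by
  have := hW.isGaussianProcess.isProbabilityMeasure
  have h1 : iIndepFun (fun (i : Fin M) ω => gridIncr W Δ M ω i) P := by
    have := hW.hasIndepIncrements M (fun j => (j : ℕ) * Δ) (fun i j hij => by
      dsimp only; gcongr; exact_mod_cast hij)
    simpa [gridIncr] using this
  have h2 := h1.map_fun_eq_pi_map
    (fun i => ((measurable_pi_apply i).comp (measurable_gridIncr hWm Δ M)).aemeasurable)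
  refine h2.trans ?_
  congr 1
  ext1 i
  change P.map (fun ω => W (((i : ℕ) + 1) * Δ) ω - W ((i : ℕ) * Δ) ω) = _
  rw [map_sub_eq_gaussianReal hW (by gcongr; simp)]
  congr 1
  rw [add_mul, one_mul, add_tsub_cancel_left]

/-- The increments after the time `jΔ`, with those before it replaced by `0`. -/
noncomputable def futureIncr (W : ℝ≥0 → Ω → ℝ) (Δ : ℝ≥0) (M j : ℕ) (ω : Ω) (i : Fin M) : ℝ :=
  if j ≤ i then gridIncr W Δ M ω i else 0

/-- The later increments are functions of the shifted process `W (jΔ + ·) - W (jΔ)`, which is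
independent of the past. -/
theorem indep_natural_futureIncr (hW : IsPreBrownianReal W P) (hWm : ∀ t, StronglyMeasurable (W t))
    (Δ : ℝ≥0) (M j : ℕ) :
    Indep (Filtration.natural W hWm (j * Δ))
      (MeasurableSpace.comap (futureIncr W Δ M j) inferInstance) P := by
  have h := (hW.indepFun_shift (j * Δ)).symm
  have h2 : Indep (Filtration.natural W hWm (j * Δ)) (MeasurableSpace.comap
      (fun ω t => W (j * Δ + t) ω - W (j * Δ) ω) inferInstance) P := by
    have e : Filtration.natural W hWm (j * Δ) = MeasurableSpace.comap
        (fun ω (t : Set.Iic (j * Δ)) => W t ω) inferInstance :=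
      Filtration.natural_eq_comap W hWm (j * Δ)
    rw [e]
    exact h
  refine indep_of_indep_of_le_right h2 ?_
  -- The truncated subtraction `i - j` only occurs where `j ≤ i`.
  have h3 : futureIncr W Δ M j = (fun (x : ℝ≥0 → ℝ) (i : Fin M) =>
      if j ≤ i then x ((((i : ℕ) - j : ℕ) + 1) * Δ) - x (((i : ℕ) - j : ℕ) * Δ) else 0) ∘
        fun ω t => W (j * Δ + t) ω - W (j * Δ) ω := by
    ext ω i
    simp only [futureIncr, gridIncr, Function.comp]
    split_ifs with hi
    · obtain ⟨k, hk⟩ := Nat.exists_eq_add_of_le hi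
      rw [hk, Nat.add_sub_cancel_left]
      push_cast
      rw [← add_mul, ← add_mul, add_assoc]
      ring
    · rfl
  rw [h3, ← MeasurableSpace.comap_comp]
  refine MeasurableSpace.comap_mono (Measurable.comap_le ?_)
  refine measurable_pi_lambda _ fun i => ?_
  by_cases hi : j ≤ (i : ℕ)
  · simp only [hi, if_true]
    fun_prop
  · simp only [hi, if_false]
    fun_prop

end Brownian

end BackwardTaylor

namespace BackwardTaylor

/-! ### Means of Malliavin derivatives over boxes of times -/

section Cylinder

variable {Ω : Type*} {W : ℝ≥0 → Ω → ℝ} {T : ℝ≥0}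

/-- Expansion in the standard basis isolates the dependence of a Malliavin derivative on the times
in products of indicators, which are integrated factor by factor. -/
theorem multilinear_apply_eq_sum {n l : ℕ}
    (f : ContinuousMultilinearMap ℝ (fun _ : Fin l => Fin n → ℝ) ℝ) (u : Fin l → Fin n → ℝ) :
    f u = ∑ i : Fin l → Fin n, (∏ j, u j (i j)) * f fun j => Pi.single (i j) 1 := by
  have hu : u = fun j => ∑ i, u j i • (Pi.single i 1 : Fin n → ℝ) := by
    ext j i
    simp [Finset.sum_apply, Pi.single_apply]
  conv_lhs => rw [hu]
  rw [f.map_sum (g := fun j i => u j i • (Pi.single i 1 : Fin n → ℝ))]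
  exact Finset.sum_congr rfl fun i _ => f.map_smul_univ (fun j => u j (i j)) _

theorem SmoothCylinder.deriv_eq_sum (S : SmoothCylinder T) (W : ℝ≥0 → Ω → ℝ) (l : ℕ)
    (p : Ω × (Fin l → ℝ)) :
    S.deriv W l p = ∑ i : Fin l → Fin S.n, (∏ j, if p.2 j ≤ (S.time (i j) : ℝ) then (1 : ℝ) else 0)
      * iteratedFDeriv ℝ l S.f (fun i => W (S.time i) p.1) fun j => Pi.single (i j) 1 :=
  multilinear_apply_eq_sum _ _

theorem continuous_iteratedFDeriv_apply {E : Type*} [NormedAddCommGroup E] [NormedSpace ℝ E]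
    {f : E → ℝ} (hf : f.HasTemperateGrowth) (l : ℕ) (v : Fin l → E) :
    Continuous fun x => iteratedFDeriv ℝ l f x v :=
  (ContinuousMultilinearMap.apply ℝ (fun _ : Fin l => E) ℝ v).continuous.comp
    (hf.1.continuous_iteratedFDeriv (by exact_mod_cast le_top))

theorem SmoothCylinder.measurable_deriv [MeasurableSpace Ω] (hW : ∀ t, Measurable (W t))
    (S : SmoothCylinder T) (l : ℕ) : Measurable (S.deriv W l) := by
  rw [funext (S.deriv_eq_sum W l)]
  refine Finset.measurable_fun_sum _ fun i _ => Measurable.mul ?_ ?_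
  · refine Finset.measurable_fun_prod _ fun j _ => Measurable.ite ?_ measurable_const measurable_const
    exact measurableSet_le ((measurable_pi_apply j).comp measurable_snd) measurable_const
  · exact (continuous_iteratedFDeriv_apply S.temperate l _).measurable.comp
      (measurable_pi_lambda _ fun i => (hW _).comp measurable_fst)

theorem setIntegral_Ioc_indicator_le {a b : ℝ} (hab : a ≤ b) (t : ℝ) :
    ∫ s in Set.Ioc a b, (if s ≤ t then (1 : ℝ) else 0) = min b t - min a t := by
  have h1 : (fun s => if s ≤ t then (1 : ℝ) else 0) = (Set.Iic t).indicator fun _ => 1 := by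
    ext s; simp [Set.indicator]
  rw [h1, setIntegral_indicator measurableSet_Iic]
  simp only [integral_const, smul_eq_mul, mul_one, measureReal_restrict_apply_univ]
  rw [Set.Ioc_inter_Iic, Real.volume_real_Ioc]
  rcases le_total a t with h | h
  · rw [min_eq_left h, max_eq_left]
    exact sub_nonneg.2 (le_min hab h)
  · rw [min_eq_right h, min_eq_right (h.trans hab), max_eq_right (by linarith), sub_self]

/-- The uniform distribution on the box `∏ (a j, b j]`. -/
noncomputable def boxMeasure {l : ℕ} (a b : Fin l → ℝ) : Measure (Fin l → ℝ) :=
  (volume.restrict (Set.univ.pi fun j => Set.Ioc (a j) (b j)) Set.univ)⁻¹ •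
    volume.restrict (Set.univ.pi fun j => Set.Ioc (a j) (b j))

theorem setAverage_box {l : ℕ} (a b : Fin l → ℝ) (f : (Fin l → ℝ) → ℝ) :
    ⨍ s in Set.univ.pi (fun j => Set.Ioc (a j) (b j)), f s = ∫ s, f s ∂(boxMeasure a b) := rfl

variable {l : ℕ} {a b : Fin l → ℝ}

theorem volume_box (a b : Fin l → ℝ) :
    volume (Set.univ.pi fun j => Set.Ioc (a j) (b j)) = ∏ j, ENNReal.ofReal (b j - a j) := by
  rw [volume_pi_pi]
  simp [Real.volume_Ioc]

theorem volume_box_ne_zero (hab : ∀ j, a j < b j) :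
    volume (Set.univ.pi fun j => Set.Ioc (a j) (b j)) ≠ 0 := by
  rw [volume_box]
  exact Finset.prod_ne_zero_iff.2 fun j _ => by simpa using hab j

theorem volume_box_ne_top (a b : Fin l → ℝ) :
    volume (Set.univ.pi fun j => Set.Ioc (a j) (b j)) ≠ ∞ := by
  rw [volume_box]
  exact ENNReal.prod_ne_top fun j _ => ENNReal.ofReal_ne_top

theorem isProbabilityMeasure_boxMeasure (hab : ∀ j, a j < b j) :
    IsProbabilityMeasure (boxMeasure a b) := by
  constructor
  rw [boxMeasure, Measure.smul_apply, smul_eq_mul, Measure.restrict_apply_univ]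
  exact ENNReal.inv_mul_cancel (volume_box_ne_zero hab) (volume_box_ne_top a b)

theorem integral_boxMeasure_prod_indicator (hab : ∀ j, a j < b j) (t : Fin l → ℝ) :
    ∫ s, ∏ j, (if s j ≤ t j then (1 : ℝ) else 0) ∂(boxMeasure a b)
      = ∏ j, ramp (a j) (b j) (t j) := by
  rw [boxMeasure, integral_smul_measure, Measure.restrict_apply_univ, volume_box, volume_pi,
    Measure.restrict_pi_pi, integral_fintype_prod_eq_prod (𝕜 := ℝ)
      (f := fun j s => if s ≤ t j then (1 : ℝ) else 0)]
  rw [ENNReal.toReal_inv, ENNReal.toReal_prod, smul_eq_mul, ← Finset.prod_inv_distrib,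
    ← Finset.prod_mul_distrib]
  refine Finset.prod_congr rfl fun j _ => ?_
  rw [setIntegral_Ioc_indicator_le (hab j).le, ENNReal.toReal_ofReal (by linarith [hab j]), ramp]
  ring

theorem integrable_prod_indicator (hab : ∀ j, a j < b j) (t : Fin l → ℝ) :
    Integrable (fun s => ∏ j, (if s j ≤ t j then (1 : ℝ) else 0)) (boxMeasure a b) := by
  have := isProbabilityMeasure_boxMeasure hab
  refine Integrable.of_bound (C := 1) (Measurable.aestronglyMeasurable ?_) (ae_of_all _ fun s => ?_)
  · refine Finset.measurable_fun_prod _ fun j _ => Measurable.ite ?_ measurable_const measurable_const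
    exact measurableSet_le (measurable_pi_apply j) measurable_const
  · rw [Real.norm_eq_abs, Finset.abs_prod]
    refine Finset.prod_le_one (fun j _ => abs_nonneg _) fun j _ => ?_
    split_ifs <;> simp

theorem SmoothCylinder.integrable_deriv (S : SmoothCylinder T) (W : ℝ≥0 → Ω → ℝ)
    (hab : ∀ j, a j < b j) (ω : Ω) :
    Integrable (fun s => S.deriv W l (ω, s)) (boxMeasure a b) := by
  simp_rw [S.deriv_eq_sum]
  exact integrable_finsetSum _ fun i _ => (integrable_prod_indicator hab _).mul_const _

/-- The `l`-th differential of the function defining a smooth cylindrical functional, in the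
Cameron–Martin directions of the uniform distributions on `(a j, b j]`. -/
noncomputable def SmoothCylinder.boxDeriv (S : SmoothCylinder T) (W : ℝ≥0 → Ω → ℝ)
    (a b : Fin l → ℝ) (ω : Ω) : ℝ :=
  iteratedFDeriv ℝ l S.f (fun i => W (S.time i) ω) fun j i => ramp (a j) (b j) (S.time i)

/-- By multilinearity the average acts on each direction separately and turns `1[s ≤ tᵢ]` into
`ramp`. These directions are the regression coefficients of `W` on the increments, which links means
of derivatives to differentiation along increments. -/
theorem SmoothCylinder.integral_deriv_boxMeasure (S : SmoothCylinder T) (W : ℝ≥0 → Ω → ℝ)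
    (hab : ∀ j, a j < b j) (ω : Ω) :
    ∫ s, S.deriv W l (ω, s) ∂(boxMeasure a b) = S.boxDeriv W a b ω := by
  simp_rw [S.deriv_eq_sum]
  rw [integral_finsetSum _ fun i _ => (integrable_prod_indicator hab _).mul_const _,
    SmoothCylinder.boxDeriv, multilinear_apply_eq_sum]
  refine Finset.sum_congr rfl fun i _ => ?_
  rw [integral_mul_const, integral_boxMeasure_prod_indicator hab]

variable [MeasurableSpace Ω] {P : Measure Ω} [IsProbabilityMeasure P]

theorem exists_prod_boxMeasure_le (P : Measure Ω) [IsProbabilityMeasure P]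
    (hab : ∀ j, a j < b j) (h0 : ∀ j, 0 ≤ a j) (hT : ∀ j, b j ≤ T) :
    ∃ c : ℝ≥0∞, c ≠ ∞ ∧ P.prod (boxMeasure a b) ≤ c • timeProd P T l := by
  refine ⟨(volume.restrict (Set.univ.pi fun j => Set.Ioc (a j) (b j)) Set.univ)⁻¹, ?_, ?_⟩
  · rw [Measure.restrict_apply_univ]
    exact ENNReal.inv_ne_top.2 (volume_box_ne_zero hab)
  · have hsub : (Set.univ.pi fun j => Set.Ioc (a j) (b j))
        ⊆ Set.univ.pi fun _ : Fin l => Set.Icc (0 : ℝ) T := fun s hs j hj =>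
      ⟨(h0 j).trans (hs j hj).1.le, (hs j hj).2.trans (hT j)⟩
    rw [boxMeasure, Measure.prod_smul_right, timeProd]
    gcongr

theorem memLp_prod_boxMeasure (hab : ∀ j, a j < b j) (h0 : ∀ j, 0 ≤ a j) (hT : ∀ j, b j ≤ T)
    {V : Ω × (Fin l → ℝ) → ℝ} (hV : MemLp V 2 (timeProd P T l)) :
    MemLp V 2 (P.prod (boxMeasure a b)) := by
  obtain ⟨c, hc, hle⟩ := exists_prod_boxMeasure_le P hab h0 hT
  exact (hV.smul_measure hc).mono_measure hle

theorem memLp_boxMean (hab : ∀ j, a j < b j) (h0 : ∀ j, 0 ≤ a j) (hT : ∀ j, b j ≤ T)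
    {V : Ω × (Fin l → ℝ) → ℝ} (hV : MemLp V 2 (timeProd P T l)) :
    MemLp (fun ω => ∫ s, V (ω, s) ∂(boxMeasure a b)) 2 P := by
  have := isProbabilityMeasure_boxMeasure hab
  have hV' := memLp_prod_boxMeasure hab h0 hT hV
  exact ⟨hV'.1.integral_prod_right', (eLpNorm_integral_prod_le hV'.1).trans_lt hV'.2⟩

/-- The uniform law on a box inside `[0, T]^l` is dominated by a multiple of Lebesgue measure there,
and averaging contracts `L²`. -/
theorem tendsto_boxDeriv (hW : ∀ t, Measurable (W t)) (hab : ∀ j, a j < b j) (h0 : ∀ j, 0 ≤ a j)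
    (hT : ∀ j, b j ≤ T) {V : Ω × (Fin l → ℝ) → ℝ} (hV : MemLp V 2 (timeProd P T l))
    {S : ℕ → SmoothCylinder T}
    (hS : Tendsto (fun n => eLpNorm (fun p => (S n).deriv W l p - V p) 2 (timeProd P T l))
      atTop (𝓝 0)) :
    Tendsto (fun n => eLpNorm (fun ω => (S n).boxDeriv W a b ω
      - ∫ s, V (ω, s) ∂(boxMeasure a b)) 2 P) atTop (𝓝 0) := by
  have := isProbabilityMeasure_boxMeasure hab
  have hV' := memLp_prod_boxMeasure hab h0 hT hV
  obtain ⟨c, hc, hle⟩ := exists_prod_boxMeasure_le P hab h0 hT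
  have hc' : c ^ (1 / (2 : ℝ≥0∞)).toReal ≠ ∞ :=
    ENNReal.rpow_ne_top_of_nonneg ENNReal.toReal_nonneg hc
  have hlim := ENNReal.Tendsto.const_mul hS (Or.inr hc')
  simp only [mul_zero] at hlim
  refine tendsto_of_tendsto_of_tendsto_of_le_of_le tendsto_const_nhds hlim (fun _ => zero_le)
    fun n => ?_
  have hae : (fun ω => (S n).boxDeriv W a b ω - ∫ s, V (ω, s) ∂(boxMeasure a b))
      =ᵐ[P] fun ω => ∫ s, ((S n).deriv W l (ω, s) - V (ω, s)) ∂(boxMeasure a b) := by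
    filter_upwards [(hV'.integrable (by norm_num)).prod_right_ae] with ω hω
    rw [integral_sub ((S n).integrable_deriv W hab ω) hω,
      (S n).integral_deriv_boxMeasure W hab]
  have hU : AEStronglyMeasurable (fun p => (S n).deriv W l p - V p) (P.prod (boxMeasure a b)) :=
    ((S n).measurable_deriv hW l).aestronglyMeasurable.sub hV'.1
  have h1 := eLpNorm_integral_prod_le hU
  have h2 := eLpNorm_mono_measure (p := 2) (fun p => (S n).deriv W l p - V p) hle
  rw [eLpNorm_smul_measure_of_ne_top (by simp), smul_eq_mul] at h2
  rw [eLpNorm_congr_ae hae]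
  exact h1.trans h2

end Cylinder

end BackwardTaylor

namespace BackwardTaylor

/-! ### Passing to the limit and integrating out an independent variable -/

section Convergence

variable {Ω : Type*} [MeasurableSpace Ω] {P : Measure Ω} [IsProbabilityMeasure P]

theorem tendsto_integral_mul_of_tendsto_eLpNorm {α : Type*} {u : Filter α} {f : α → Ω → ℝ}
    {g b : Ω → ℝ} (hf : ∀ᶠ n in u, Integrable (f n) P) (hg : Integrable g P)
    (hb : AEStronglyMeasurable b P) {c : ℝ} (hbc : ∀ ω, ‖b ω‖ ≤ c)
    (h : Tendsto (fun n => eLpNorm (fun ω => f n ω - g ω) 2 P) u (𝓝 0)) :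
    Tendsto (fun n => ∫ ω, f n ω * b ω ∂P) u (𝓝 (∫ ω, g ω * b ω ∂P)) := by
  have hlim := ENNReal.Tendsto.const_mul (a := ENNReal.ofReal c) h (Or.inr ENNReal.ofReal_ne_top)
  simp only [mul_zero] at hlim
  refine tendsto_integral_of_L1' _ (hg.mul_bdd hb (ae_of_all _ hbc)).aestronglyMeasurable
    (hf.mono fun n hn => hn.mul_bdd hb (ae_of_all _ hbc)) ?_
  refine tendsto_of_tendsto_of_tendsto_of_le_of_le' tendsto_const_nhds hlim
    (Eventually.of_forall fun _ => zero_le) (hf.mono fun n hn => ?_)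
  have h1 : eLpNorm ((fun ω => f n ω * b ω) - fun ω => g ω * b ω) 1 P
      ≤ ENNReal.ofReal c * eLpNorm (fun ω => f n ω - g ω) 1 P := by
    refine eLpNorm_le_mul_eLpNorm_of_ae_le_mul (ae_of_all _ fun ω => ?_) 1
    simp only [Pi.sub_apply]
    rw [← sub_mul, norm_mul, mul_comm]
    exact mul_le_mul_of_nonneg_right (hbc ω) (norm_nonneg _)
  refine h1.trans ?_
  gcongr
  exact eLpNorm_le_eLpNorm_of_exponent_le (by norm_num) (hn.sub hg).aestronglyMeasurable

theorem integral_comp_eq_of_indepFun {S : Type*} [MeasurableSpace S] {R : Ω → S} {Y : Ω → ℝ}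
    (hR : Measurable R) (hY : Measurable Y) (h : IndepFun R Y P) {g₁ g₂ : S × ℝ → ℝ}
    (hg₁ : Measurable g₁) (hg₂ : Measurable g₂) (hi₁ : Integrable (fun ω => g₁ (R ω, Y ω)) P)
    (hi₂ : Integrable (fun ω => g₂ (R ω, Y ω)) P)
    (heq : ∀ r, ∫ y, g₁ (r, y) ∂(P.map Y) = ∫ y, g₂ (r, y) ∂(P.map Y)) :
    ∫ ω, g₁ (R ω, Y ω) ∂P = ∫ ω, g₂ (R ω, Y ω) ∂P := by
  have hlaw := (indepFun_iff_map_prod_eq_prod_map_map hR.aemeasurable hY.aemeasurable).1 h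
  have hRY : Measurable fun ω => (R ω, Y ω) := hR.prodMk hY
  have key : ∀ {g : S × ℝ → ℝ}, Measurable g → Integrable (fun ω => g (R ω, Y ω)) P →
      ∫ ω, g (R ω, Y ω) ∂P = ∫ r, (∫ y, g (r, y) ∂(P.map Y)) ∂(P.map R) := by
    intro g hg hi
    rw [← integral_map (f := g) hRY.aemeasurable hg.aestronglyMeasurable, hlaw, integral_prod]
    rw [← hlaw]
    exact (integrable_map_measure hg.aestronglyMeasurable hRY.aemeasurable).2 hi
  rw [key hg₁ hi₁, key hg₂ hi₂]
  simp_rw [heq]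

theorem integrable_iteratedFDeriv_comp {E : Type*} [NormedAddCommGroup E] [NormedSpace ℝ E]
    [CompleteSpace E] [SecondCountableTopology E] [MeasurableSpace E] [BorelSpace E]
    {Ω : Type*} [MeasurableSpace Ω] {P : Measure Ω} {f : E → ℝ} (hf : f.HasTemperateGrowth) {Z : Ω → E} (hZ : HasGaussianLaw Z P) (l : ℕ) (v : Fin l → E) :
    Integrable (fun ω => iteratedFDeriv ℝ l f (Z ω) v) P := by
  obtain ⟨k, C, h⟩ := hf.2 l
  refine Integrable.mono' ((HasGaussianLaw.integrable_one_add_norm_pow hZ k).const_mul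
    (C * ∏ j, ‖v j‖)) ?_ (ae_of_all _ fun ω => ?_)
  · exact (continuous_iteratedFDeriv_apply hf l v).measurable.comp_aemeasurable hZ.aemeasurable
      |>.aestronglyMeasurable
  · refine ((iteratedFDeriv ℝ l f (Z ω)).le_opNorm v).trans ?_
    rw [mul_right_comm]
    exact mul_le_mul_of_nonneg_right (h _) (Finset.prod_nonneg fun _ _ => norm_nonneg _)

end Convergence

/-! ### Gaussian integration by parts and uniqueness of the derivative -/

section Uniqueness

variable {Ω : Type*} [MeasurableSpace Ω] {P : Measure Ω} {W : ℝ≥0 → Ω → ℝ} {T : ℝ≥0}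

theorem SmoothCylinder.hasGaussianLaw (hW : IsPreBrownianReal W P) (S : SmoothCylinder T) :
    HasGaussianLaw (fun ω i => W (S.time i) ω) P :=
  IsGaussianProcess.hasGaussianLaw_pi (hW.isGaussianProcess.comp_right S.time)

theorem SmoothCylinder.integrable_boxDeriv (hW : IsPreBrownianReal W P) (S : SmoothCylinder T)
    {l : ℕ} (a b : Fin l → ℝ) : Integrable (S.boxDeriv W a b) P := by
  exact integrable_iteratedFDeriv_comp S.temperate (S.hasGaussianLaw hW) l _

theorem SmoothCylinder.integrable_eval (hW : IsPreBrownianReal W P) (S : SmoothCylinder T) :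
    Integrable (S.eval W) P := by
  have := integrable_iteratedFDeriv_comp S.temperate (S.hasGaussianLaw hW) 0 (fun _ => 0)
  simp only [iteratedFDeriv_zero_apply] at this
  exact this

theorem contDiff_gaussianPDFReal (v : ℝ≥0) : ContDiff ℝ (⊤ : ℕ∞) (gaussianPDFReal 0 v) := by
  rw [gaussianPDFReal_def]
  fun_prop

/-- The adjoint of the `l`-th derivative in `L²(N(0, v))`, up to sign. -/
noncomputable def gaussianAdjoint (v : ℝ≥0) (l : ℕ) (φ : ℝ → ℝ) (y : ℝ) : ℝ :=
  iteratedDeriv l (fun y => φ y * gaussianPDFReal 0 v y) y / gaussianPDFReal 0 v y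

theorem continuous_gaussianAdjoint {v : ℝ≥0} (hv : v ≠ 0) (l : ℕ) {φ : ℝ → ℝ}
    (hφ : ContDiff ℝ (⊤ : ℕ∞) φ) : Continuous (gaussianAdjoint v l φ) := by
  refine Continuous.div ?_ (contDiff_gaussianPDFReal v).continuous
    fun y => (gaussianPDFReal_pos 0 v y hv).ne'
  rw [iteratedDeriv_eq_iterate]
  exact ((hφ.mul (contDiff_gaussianPDFReal v)).iterate_deriv l).continuous

theorem hasCompactSupport_iteratedDeriv {χ : ℝ → ℝ} (h : HasCompactSupport χ) (l : ℕ) :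
    HasCompactSupport (iteratedDeriv l χ) := by
  induction l with
  | zero => simpa
  | succ n ih => rw [iteratedDeriv_succ]; exact ih.deriv

theorem hasCompactSupport_gaussianAdjoint (v : ℝ≥0) (l : ℕ) {φ : ℝ → ℝ}
    (hc : HasCompactSupport φ) : HasCompactSupport (gaussianAdjoint v l φ) := by
  have h := hasCompactSupport_iteratedDeriv (hc.mul_right (f' := gaussianPDFReal 0 v)) l
  exact h.mono fun y hy => fun h0 => hy (by
    change iteratedDeriv l (fun y => φ y * gaussianPDFReal 0 v y) y = 0 at h0
    simp [gaussianAdjoint, h0])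

/-- The density is absorbed into the test function, which keeps its compact support; the rest is
integration by parts for Lebesgue measure. -/
theorem integral_iteratedDeriv_mul_gaussianReal {v : ℝ≥0} (hv : v ≠ 0) (l : ℕ) {φ u : ℝ → ℝ}
    (hφ : ContDiff ℝ (⊤ : ℕ∞) φ) (hc : HasCompactSupport φ) (hu : ContDiff ℝ (⊤ : ℕ∞) u) :
    ∫ y, iteratedDeriv l u y * φ y ∂(gaussianReal 0 v)
      = (-1) ^ l * ∫ y, u y * gaussianAdjoint v l φ y ∂(gaussianReal 0 v) := by
  rw [integral_gaussianReal_eq_integral_smul hv, integral_gaussianReal_eq_integral_smul hv]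
  have h := integral_iteratedDeriv_mul (hφ.mul (contDiff_gaussianPDFReal v))
    (hc.mul_right (f' := gaussianPDFReal 0 v)) l hu
  convert h using 2
  · ext y; simp only [smul_eq_mul]; ring
  · congr 1
    ext y
    have := (gaussianPDFReal_pos 0 v y hv).ne'
    simp only [smul_eq_mul, gaussianAdjoint]
    field_simp

theorem measurable_residual {ι : Type*} [Fintype ι] (hWm : ∀ t, Measurable (W t)) (a b : ι → ℝ≥0) :
    Measurable fun ω s => residual W a b s ω :=
  measurable_pi_lambda _ fun s => by simp only [residual]; fun_prop

theorem eq_residual_add {Ω : Type*} (W : ℝ≥0 → Ω → ℝ) (u t s : ℝ≥0) (ω : Ω) :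
    W s ω = residual W (fun _ : Unit => u) (fun _ => t) s ω
      + (W t ω - W u ω) * ramp u t s := by
  simp [residual]; ring

/-- With the residual frozen at `r`, the path is `r + y · ramp`, affine in the increment `y`, and
`boxDeriv` is the `l`-th derivative along this line. The residual is independent of `y`, so one
integrates by parts in `y` with the indicator of `A` as a constant factor. -/
theorem SmoothCylinder.integral_boxDeriv_mul (hW : IsPreBrownianReal W P)
    (hWm : ∀ t, Measurable (W t)) (S : SmoothCylinder T) (l : ℕ) {u t : ℝ≥0} (hut : u < t)
    {A : Set (ℝ≥0 → ℝ)} (hA : MeasurableSet A) {φ : ℝ → ℝ}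
    (hφ : ContDiff ℝ (⊤ : ℕ∞) φ) (hc : HasCompactSupport φ) :
    ∫ ω, S.boxDeriv W (fun _ : Fin l => (u : ℝ)) (fun _ => t) ω *
        (A.indicator 1 (fun s => residual W (fun _ : Unit => u) (fun _ => t) s ω)
          * φ (W t ω - W u ω)) ∂P
      = (-1) ^ l * ∫ ω, S.eval W ω *
        (A.indicator 1 (fun s => residual W (fun _ : Unit => u) (fun _ => t) s ω)
          * gaussianAdjoint (t - u) l φ (W t ω - W u ω)) ∂P := by
  have := hW.isGaussianProcess.isProbabilityMeasure
  have hv : t - u ≠ 0 := (tsub_pos_of_lt hut).ne'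
  set R : Ω → ℝ≥0 → ℝ := fun ω s => residual W (fun _ : Unit => u) (fun _ => t) s ω with hRdef
  set Y : Ω → ℝ := fun ω => W t ω - W u ω with hYdef
  have hY : Measurable Y := (hWm t).sub (hWm u)
  have hR : Measurable R := measurable_residual hWm _ _
  have hind : IndepFun R Y P := by
    have := indepFun_residual hW (a := fun _ : Unit => u) (b := fun _ => t) (fun _ => hut)
      (fun β γ h => absurd (Subsingleton.elim _ _) h)
    exact this.comp (φ := id) (ψ := fun y : Unit → ℝ => y ()) measurable_id (measurable_pi_apply _)
  set h : Fin S.n → ℝ := fun i => ramp u t (S.time i) with hh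
  let pt : (ℝ≥0 → ℝ) × ℝ → Fin S.n → ℝ := fun p => (fun i => p.1 (S.time i)) + p.2 • h
  have hpt : Measurable pt := by fun_prop
  have hWpt : ∀ ω, (fun i => W (S.time i) ω) = pt (R ω, Y ω) := fun ω => by
    ext i
    simp only [pt, Pi.add_apply, Pi.smul_apply, smul_eq_mul]
    exact eq_residual_add W u t (S.time i) ω
  have hAm : Measurable (A.indicator (1 : (ℝ≥0 → ℝ) → ℝ)) := measurable_one.indicator hA
  have hψ := continuous_gaussianAdjoint hv l hφ
  have hψc := hasCompactSupport_gaussianAdjoint (t - u) l hc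
  have hbdd : ∀ {ψ : ℝ → ℝ}, Continuous ψ → HasCompactSupport ψ → ∀ {k : Ω → ℝ}, Integrable k P →
      Integrable (fun ω => k ω * (A.indicator 1 (R ω) * ψ (Y ω))) P := by
    intro ψ hψ hψc k hk
    obtain ⟨c, hcb⟩ := hψ.bounded_above_of_compact_support hψc
    refine hk.mul_bdd (c := 1 * c) ((hAm.comp hR).mul (hψ.measurable.comp hY)).aestronglyMeasurable
      (ae_of_all _ fun ω => ?_)
    rw [norm_mul]
    refine mul_le_mul ?_ (hcb _) (norm_nonneg _) zero_le_one
    by_cases hω : R ω ∈ A <;> simp [hω]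
  have hi₁ := hbdd hφ.continuous hc (S.integrable_boxDeriv hW (fun _ : Fin l => (u : ℝ)) fun _ => t)
  have hi₂ := (hbdd hψ hψc (S.integrable_eval hW)).const_mul ((-1) ^ l)
  rw [← integral_const_mul]
  have e₁ : ∀ ω, S.boxDeriv W (fun _ : Fin l => (u : ℝ)) (fun _ => t) ω
      = iteratedFDeriv ℝ l S.f (pt (R ω, Y ω)) fun _ => h := fun ω => by
    rw [SmoothCylinder.boxDeriv, hWpt]
  have e₂ : ∀ ω, S.eval W ω = S.f (pt (R ω, Y ω)) := fun ω => by
    rw [SmoothCylinder.eval, hWpt]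
  simp only [e₁, e₂] at hi₁ hi₂ ⊢
  refine integral_comp_eq_of_indepFun hR hY hind
    (g₁ := fun p => iteratedFDeriv ℝ l S.f (pt p) (fun _ => h) * (A.indicator 1 p.1 * φ p.2))
    (g₂ := fun p => (-1) ^ l * (S.f (pt p) *
      (A.indicator 1 p.1 * gaussianAdjoint (t - u) l φ p.2))) ?_ ?_ hi₁ hi₂ fun r => ?_
  · exact ((continuous_iteratedFDeriv_apply S.temperate l _).measurable.comp hpt).mul
      ((hAm.comp measurable_fst).mul (hφ.continuous.measurable.comp measurable_snd))
  · exact ((S.temperate.1.continuous.measurable.comp hpt).mul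
      ((hAm.comp measurable_fst).mul (hψ.measurable.comp measurable_snd))).const_mul _
  · rw [map_sub_eq_gaussianReal hW hut.le, integral_const_mul]
    have hline : ∀ y, iteratedFDeriv ℝ l S.f (pt (r, y)) (fun _ => h)
        = iteratedDeriv l (fun y : ℝ => S.f (pt (r, y))) y := fun y =>
      (iteratedDeriv_comp_line S.temperate.1 (fun i => r (S.time i)) h l y).symm
    have hu : ContDiff ℝ (⊤ : ℕ∞) fun y : ℝ => S.f (pt (r, y)) :=
      S.temperate.1.comp (contDiff_const.add (contDiff_id.smul contDiff_const))
    have h1 := integral_iteratedDeriv_mul_gaussianReal hv l hφ hc hu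
    simp only [hline]
    calc _ = A.indicator 1 r * ∫ y, iteratedDeriv l (fun y : ℝ => S.f (pt (r, y))) y * φ y
            ∂(gaussianReal 0 (t - u)) := by
          rw [← integral_const_mul]; congr 1; ext y; ring
      _ = (-1) ^ l * (A.indicator 1 r * ∫ y, S.f (pt (r, y)) * gaussianAdjoint (t - u) l φ y
            ∂(gaussianReal 0 (t - u))) := by rw [h1]; ring
      _ = _ := by
          rw [← integral_const_mul]; congr 2; ext y; ring

/-- The limit of the integration by parts formula along the approximating sequence. The right side
involves `F` but not `U`: this is the closability of the derivative. -/
theorem HasMalliavinDeriv.integral_boxMean_mul (hW : IsPreBrownianReal W P)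
    (hWm : ∀ t, Measurable (W t)) {F : Ω → ℝ} {l : ℕ} {U : Ω × (Fin l → ℝ) → ℝ}
    (hU : HasMalliavinDeriv W P T F l U) {u t : ℝ≥0} (hut : u < t) (htT : t ≤ T)
    {A : Set (ℝ≥0 → ℝ)} (hA : MeasurableSet A) {φ : ℝ → ℝ}
    (hφ : ContDiff ℝ (⊤ : ℕ∞) φ) (hc : HasCompactSupport φ) :
    ∫ ω, (∫ s, U (ω, s) ∂(boxMeasure (fun _ : Fin l => (u : ℝ)) fun _ => t)) *
        (A.indicator 1 (fun s => residual W (fun _ : Unit => u) (fun _ => t) s ω)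
          * φ (W t ω - W u ω)) ∂P
      = (-1) ^ l * ∫ ω, F ω *
        (A.indicator 1 (fun s => residual W (fun _ : Unit => u) (fun _ => t) s ω)
          * gaussianAdjoint (t - u) l φ (W t ω - W u ω)) ∂P := by
  have := hW.isGaussianProcess.isProbabilityMeasure
  have hv : t - u ≠ 0 := (tsub_pos_of_lt hut).ne'
  obtain ⟨hF, V, S, rfl, hS, hV⟩ := hU
  obtain ⟨hVl, hSl⟩ := hV l le_rfl
  have hab : ∀ _ : Fin l, (u : ℝ) < t := fun _ => by exact_mod_cast hut
  have h0 : ∀ _ : Fin l, (0 : ℝ) ≤ u := fun _ => u.2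
  have hT : ∀ _ : Fin l, (t : ℝ) ≤ T := fun _ => by exact_mod_cast htT
  have hlim := tendsto_boxDeriv hWm hab h0 hT hVl hSl
  have hR : Measurable fun ω s => residual W (fun _ : Unit => u) (fun _ => t) s ω :=
    measurable_residual hWm _ _
  have hY : Measurable fun ω => W t ω - W u ω := (hWm t).sub (hWm u)
  have hAm : Measurable (A.indicator (1 : (ℝ≥0 → ℝ) → ℝ)) := measurable_one.indicator hA
  have hbd : ∀ {ψ : ℝ → ℝ}, Continuous ψ → HasCompactSupport ψ →
      AEStronglyMeasurable (fun ω => A.indicator 1 (fun s => residual W (fun _ : Unit => u)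
        (fun _ => t) s ω) * ψ (W t ω - W u ω)) P ∧
      ∃ c, ∀ ω, ‖A.indicator 1 (fun s => residual W (fun _ : Unit => u)
        (fun _ => t) s ω) * ψ (W t ω - W u ω)‖ ≤ c := by
    intro ψ hψ hψc
    refine ⟨((hAm.comp hR).mul (hψ.measurable.comp hY)).aestronglyMeasurable, ?_⟩
    obtain ⟨c, hcb⟩ := hψ.bounded_above_of_compact_support hψc
    refine ⟨1 * c, fun ω => ?_⟩
    rw [norm_mul]
    refine mul_le_mul ?_ (hcb _) (norm_nonneg _) zero_le_one
    by_cases hω : (fun s => residual W (fun _ : Unit => u) (fun _ => t) s ω) ∈ A <;> simp [hω]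
  obtain ⟨hm₁, c₁, hc₁⟩ := hbd hφ.continuous hc
  obtain ⟨hm₂, c₂, hc₂⟩ := hbd (continuous_gaussianAdjoint hv l hφ)
    (hasCompactSupport_gaussianAdjoint (t - u) l hc)
  have l₁ := tendsto_integral_mul_of_tendsto_eLpNorm
    (Eventually.of_forall fun n => (S n).integrable_boxDeriv hW _ _)
    ((memLp_boxMean hab h0 hT hVl).integrable (by norm_num)) hm₁ hc₁ hlim
  have l₂ := (tendsto_integral_mul_of_tendsto_eLpNorm
    (Eventually.of_forall fun n => (S n).integrable_eval hW)
    (hF.integrable (by norm_num)) hm₂ hc₂ hS).const_mul ((-1) ^ l)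
  refine tendsto_nhds_unique l₁ (l₂.congr fun n => ?_)
  exact ((S n).integral_boxDeriv_mul hW hWm l hut hA hφ hc).symm

/-- The whole path is recovered from the residual and one increment, so events of `σ(W)` are events
in this pair. Rectangles suffice, and on them the integration by parts formula gives both sides the
same value against test functions of the increment. -/
theorem HasMalliavinDeriv.setIntegral_boxMean_eq (hW : IsPreBrownianReal W P)
    (hWm : ∀ t, Measurable (W t)) {F : Ω → ℝ} {l : ℕ} {U U' : Ω × (Fin l → ℝ) → ℝ}
    (hU : HasMalliavinDeriv W P T F l U) (hU' : HasMalliavinDeriv W P T F l U') {u t : ℝ≥0}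
    (hut : u < t) (htT : t ≤ T) {C : Set Ω}
    (hC : MeasurableSet[MeasurableSpace.comap (fun ω s => W s ω) inferInstance] C) :
    ∫ ω in C, (∫ s, U (ω, s) ∂(boxMeasure (fun _ : Fin l => (u : ℝ)) fun _ => t)) ∂P
      = ∫ ω in C, (∫ s, U' (ω, s) ∂(boxMeasure (fun _ : Fin l => (u : ℝ)) fun _ => t)) ∂P := by
  have := hW.isGaussianProcess.isProbabilityMeasure
  have hab : ∀ _ : Fin l, (u : ℝ) < t := fun _ => by exact_mod_cast hut
  have h0 : ∀ _ : Fin l, (0 : ℝ) ≤ u := fun _ => u.2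
  have hT : ∀ _ : Fin l, (t : ℝ) ≤ T := fun _ => by exact_mod_cast htT
  have hint : ∀ {U}, HasMalliavinDeriv W P T F l U → Integrable (fun ω =>
      ∫ s, U (ω, s) ∂(boxMeasure (fun _ : Fin l => (u : ℝ)) fun _ => t)) P := by
    rintro _ ⟨-, V, S, rfl, -, hV⟩
    exact (memLp_boxMean hab h0 hT (hV l le_rfl).1).integrable (by norm_num)
  set H := fun ω => ∫ s, U (ω, s) ∂(boxMeasure (fun _ : Fin l => (u : ℝ)) fun _ => t)
  set H' := fun ω => ∫ s, U' (ω, s) ∂(boxMeasure (fun _ : Fin l => (u : ℝ)) fun _ => t)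
  have hH : Integrable H P := hint hU
  have hH' : Integrable H' P := hint hU'
  let R : Ω → ℝ≥0 → ℝ := fun ω s => residual W (fun _ : Unit => u) (fun _ => t) s ω
  have hR : Measurable R := measurable_residual hWm _ _
  let Y : Ω → ℝ := fun ω => W t ω - W u ω
  have hY : Measurable Y := (hWm t).sub (hWm u)
  rw [← sub_eq_zero, ← integral_sub hH.integrableOn hH'.integrableOn]
  obtain ⟨D, hD, rfl⟩ := hC
  have hΘ : Measurable fun (p : (ℝ≥0 → ℝ) × ℝ) (s : ℝ≥0) => p.1 s + p.2 * ramp u t s := by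
    fun_prop
  have hpre : (fun ω s => W s ω) ⁻¹' D = (fun ω => (R ω, Y ω)) ⁻¹'
      ((fun (p : (ℝ≥0 → ℝ) × ℝ) (s : ℝ≥0) => p.1 s + p.2 * ramp u t s) ⁻¹' D) := by
    ext ω
    have : (fun s => W s ω) = fun s : ℝ≥0 => R ω s + Y ω * ramp u t s :=
      funext fun s => eq_residual_add W u t s ω
    simp only [Set.mem_preimage, this]
  rw [hpre]
  refine setIntegral_eq_zero_of_prodMk (hH.sub hH') hR hY (fun A B hA hB => ?_) (hΘ hD)
  refine setIntegral_preimage_eq_zero_of_contDiff (hH.sub hH') hY (hR hA) (fun φ hφ hc => ?_) hB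
  have h1 := hU.integral_boxMean_mul hW hWm hut htT hA hφ hc
  have h2 := hU'.integral_boxMean_mul hW hWm hut htT hA hφ hc
  obtain ⟨c, hcb⟩ := hφ.continuous.bounded_above_of_compact_support hc
  have e : ∀ K : Ω → ℝ, ∫ ω in R ⁻¹' A, K ω * φ (Y ω) ∂P
      = ∫ ω, K ω * (A.indicator 1 (R ω) * φ (Y ω)) ∂P := fun K => by
    rw [← integral_indicator (hR hA)]
    refine integral_congr_ae (ae_of_all _ fun ω => ?_)
    by_cases hω : R ω ∈ A <;> simp [hω]
  have hbi : ∀ {K : Ω → ℝ}, Integrable K P → Integrable (fun ω => K ω * φ (Y ω)) P := fun hK =>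
    hK.mul_bdd (hφ.continuous.measurable.comp hY).aestronglyMeasurable (ae_of_all _ fun ω => hcb _)
  have e2 : ∀ ω, (H - H') ω * φ (Y ω) = H ω * φ (Y ω) - H' ω * φ (Y ω) := fun ω => by
    simp only [Pi.sub_apply]; ring
  simp only [e2]
  rw [integral_sub (hbi hH).integrableOn (hbi hH').integrableOn, e, e, sub_eq_zero]
  exact h1.trans h2.symm

/-- For `0 < ε < t` the means over `(t - ε, t]^l` have equal integrals over `C`, and both sides are
limits of these. -/
theorem HasMalliavinDerivAt.setIntegral_eq (hW : IsPreBrownianReal W P)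
    (hWm : ∀ t, Measurable (W t)) {F G G' : Ω → ℝ} {l : ℕ} {t : ℝ≥0} (ht : 0 < t) (htT : t ≤ T)
    (hG : HasMalliavinDerivAt W P T F l t G) (hG' : HasMalliavinDerivAt W P T F l t G') {C : Set Ω}
    (hC : MeasurableSet[MeasurableSpace.comap (fun ω s => W s ω) inferInstance] C) :
    ∫ ω in C, G ω ∂P = ∫ ω in C, G' ω ∂P := by
  have := hW.isGaussianProcess.isProbabilityMeasure
  obtain ⟨hG2, U, hU, hlim⟩ := hG
  obtain ⟨hG2', U', hU', hlim'⟩ := hG'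
  have hCm : MeasurableSet C := by
    have : Measurable fun ω s => W s ω := measurable_pi_lambda _ hWm
    exact this.comap_le C hC
  have hev : ∀ᶠ ε : ℝ in 𝓝[>] 0, 0 < ε ∧ ε < t := by
    filter_upwards [Ioo_mem_nhdsGT (show (0 : ℝ) < t by exact_mod_cast ht)] with ε hε using hε
  have hT : ∀ _ : Fin l, (t : ℝ) ≤ T := fun _ => by exact_mod_cast htT
  have hint : ∀ {U}, HasMalliavinDeriv W P T F l U → ∀ᶠ ε : ℝ in 𝓝[>] 0, Integrable (fun ω =>
      ∫ s, U (ω, s) ∂(boxMeasure (fun _ : Fin l => (t : ℝ) - ε) fun _ => t)) P := by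
    rintro _ ⟨-, V, S, rfl, -, hV⟩
    filter_upwards [hev] with ε hε
    exact (memLp_boxMean (fun _ => by linarith [hε.1]) (fun _ => by linarith [hε.2]) hT
      (hV l le_rfl).1).integrable (by norm_num)
  have key : ∀ {U G}, HasMalliavinDeriv W P T F l U → MemLp G 2 P →
      Tendsto (fun ε : ℝ => eLpNorm (fun ω => (∫ s, U (ω, s) ∂(boxMeasure
        (fun _ : Fin l => (t : ℝ) - ε) fun _ => t)) - G ω) 2 P) (𝓝[>] 0) (𝓝 0) →
      Tendsto (fun ε : ℝ => ∫ ω in C, (∫ s, U (ω, s) ∂(boxMeasure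
        (fun _ : Fin l => (t : ℝ) - ε) fun _ => t)) ∂P) (𝓝[>] 0) (𝓝 (∫ ω in C, G ω ∂P)) := by
    intro U G hU hG hl
    have e : ∀ K : Ω → ℝ, ∫ ω, K ω * C.indicator 1 ω ∂P = ∫ ω in C, K ω ∂P := fun K => by
      rw [← integral_indicator hCm]
      refine integral_congr_ae (ae_of_all _ fun ω => ?_)
      by_cases hω : ω ∈ C <;> simp [hω]
    have := tendsto_integral_mul_of_tendsto_eLpNorm (b := C.indicator 1) (c := 1) (hint hU)
      (hG.integrable (by norm_num)) (measurable_one.indicator hCm).aestronglyMeasurable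
      (fun ω => by by_cases hω : ω ∈ C <;> simp [hω]) hl
    simpa only [e] using this
  refine tendsto_nhds_unique (key hU hG2 hlim) ((key hU' hG2' hlim').congr' ?_)
  filter_upwards [hev] with ε hε
  have hu : ((Real.toNNReal (t - ε) : ℝ≥0) : ℝ) = t - ε :=
    Real.coe_toNNReal _ (by linarith [hε.2])
  have := hU'.setIntegral_boxMean_eq hW hWm hU (u := Real.toNNReal (t - ε)) (t := t)
    (by rw [← NNReal.coe_lt_coe, hu]; linarith [hε.1]) htT hC
  rwa [hu] at this

end Uniqueness

end BackwardTaylor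

namespace BackwardTaylor

/-! ### Conditioning cylindrical functionals on the grid increments -/

section Projection

variable {Ω : Type*} [MeasurableSpace Ω] {P : Measure Ω} {W : ℝ≥0 → Ω → ℝ} {T Δ : ℝ≥0} {M : ℕ}

/-- The left endpoints of the cells of the grid. -/
noncomputable def cellLeft (Δ : ℝ≥0) {M : ℕ} (β : Fin M) : ℝ≥0 := (β : ℕ) * Δ

/-- The right endpoints of the cells of the grid. -/
noncomputable def cellRight (Δ : ℝ≥0) {M : ℕ} (β : Fin M) : ℝ≥0 := ((β : ℕ) + 1) * Δ

theorem cellLeft_lt_cellRight (hΔ : 0 < Δ) (β : Fin M) : cellLeft Δ β < cellRight Δ β := by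
  unfold cellLeft cellRight
  gcongr
  simp

theorem cellRight_le (Δ : ℝ≥0) (β : Fin M) : cellRight Δ β ≤ M * Δ := by
  unfold cellRight
  gcongr
  exact_mod_cast β.2

theorem cellRight_le_cellLeft_or (Δ : ℝ≥0) (β γ : Fin M) (h : β ≠ γ) :
    cellRight Δ β ≤ cellLeft Δ γ ∨ cellRight Δ γ ≤ cellLeft Δ β := by
  unfold cellLeft cellRight
  rcases lt_or_gt_of_ne h with h | h
  · left; gcongr; exact_mod_cast h
  · right; gcongr; exact_mod_cast h

theorem indepFun_gridIncr_residual (hW : IsPreBrownianReal W P) (hΔ : 0 < Δ) {n : ℕ}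
    (time : Fin n → ℝ≥0) :
    IndepFun (gridIncr W Δ M)
      (fun ω i => residual W (cellLeft Δ (M := M)) (cellRight Δ) (time i) ω) P := by
  have h := indepFun_residual hW (cellLeft_lt_cellRight (M := M) hΔ) (cellRight_le_cellLeft_or Δ)
  exact (h.comp (φ := fun x i => x (time i)) (ψ := id) (by fun_prop) measurable_id).symm

/-- The matrix of the regression of `(W t₁, …, W tₙ)` on the increments over the grid. -/
noncomputable def regression (Δ : ℝ≥0) (M : ℕ) {n : ℕ} (time : Fin n → ℝ≥0) :
    (Fin M → ℝ) →L[ℝ] (Fin n → ℝ) :=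
  ContinuousLinearMap.pi fun i => ∑ β : Fin M,
    ramp (cellLeft Δ β) (cellRight Δ β) (time i) • ContinuousLinearMap.proj β

theorem regression_single (Δ : ℝ≥0) {n : ℕ} (time : Fin n → ℝ≥0) (β : Fin M) :
    regression Δ M time (Pi.single β 1)
      = fun i => ramp (cellLeft Δ β) (cellRight Δ β) (time i) := by
  ext i
  simp [regression, Pi.single_apply]

theorem regression_add_residual {Ω : Type*} (W : ℝ≥0 → Ω → ℝ) (Δ : ℝ≥0) (M : ℕ) {n : ℕ}
    (time : Fin n → ℝ≥0) (ω : Ω) :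
    (fun i => W (time i) ω) = regression Δ M time (gridIncr W Δ M ω)
      + fun i => residual W (cellLeft Δ (M := M)) (cellRight Δ) (time i) ω := by
  ext i
  simp [regression, residual, gridIncr, cellLeft, cellRight]

/-- The function `x ↦ E[f (W t₁, …, W tₙ) | X = x]` of the increments `X` over the grid. -/
noncomputable def SmoothCylinder.gridFun (S : SmoothCylinder T) (W : ℝ≥0 → Ω → ℝ) (P : Measure Ω)
    (Δ : ℝ≥0) (M : ℕ) (x : Fin M → ℝ) : ℝ :=
  ∫ c, S.f (regression Δ M S.time x + c)
    ∂(P.map fun ω i => residual W (cellLeft Δ (M := M)) (cellRight Δ) (S.time i) ω)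

theorem SmoothCylinder.integrable_residual_pow (hW : IsPreBrownianReal W P)
    (S : SmoothCylinder T) (k : ℕ) :
    Integrable (fun c => (1 + ‖c‖) ^ k)
      (P.map fun ω i => residual W (cellLeft Δ (M := M)) (cellRight Δ) (S.time i) ω) := by
  have hG : HasGaussianLaw
      (fun ω i => residual W (cellLeft Δ (M := M)) (cellRight Δ) (S.time i) ω) P :=
    IsGaussianProcess.hasGaussianLaw_pi (isGaussianProcess_of_mem_span hW.isGaussianProcess
      fun i => residual_mem_span _ _ (S.time i))
  rw [integrable_map_measure (by fun_prop) hG.aemeasurable]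
  exact HasGaussianLaw.integrable_one_add_norm_pow hG k

theorem SmoothCylinder.gridFun_eq_comp (S : SmoothCylinder T) (W : ℝ≥0 → Ω → ℝ) (P : Measure Ω)
    (Δ : ℝ≥0) (M : ℕ) :
    S.gridFun W P Δ M = (fun y => ∫ c, S.f (y + c)
      ∂(P.map fun ω i => residual W (cellLeft Δ (M := M)) (cellRight Δ) (S.time i) ω)) ∘
      regression Δ M S.time := rfl

theorem SmoothCylinder.hasTemperateGrowth_gridFun (hW : IsPreBrownianReal W P)
    (S : SmoothCylinder T) (Δ : ℝ≥0) (M : ℕ) : (S.gridFun W P Δ M).HasTemperateGrowth := by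
  have := hW.isGaussianProcess.isProbabilityMeasure
  rw [S.gridFun_eq_comp]
  exact (hasTemperateGrowth_average S.temperate (S.integrable_residual_pow hW)).comp
    (ContinuousLinearMap.hasTemperateGrowth _)

theorem SmoothCylinder.iteratedFDeriv_gridFun (hW : IsPreBrownianReal W P)
    (S : SmoothCylinder T) (Δ : ℝ≥0) (M l : ℕ) (x : Fin M → ℝ) (v : Fin l → Fin M → ℝ) :
    iteratedFDeriv ℝ l (S.gridFun W P Δ M) x v
      = ∫ c, iteratedFDeriv ℝ l S.f (regression Δ M S.time x + c)
          (fun j => regression Δ M S.time (v j))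
        ∂(P.map fun ω i => residual W (cellLeft Δ (M := M)) (cellRight Δ) (S.time i) ω) := by
  have := hW.isGaussianProcess.isProbabilityMeasure
  rw [S.gridFun_eq_comp, ContinuousLinearMap.iteratedFDeriv_comp_right (n := (⊤ : ℕ∞)) _
    (hasTemperateGrowth_average S.temperate (S.integrable_residual_pow hW)).1 _
    (by exact_mod_cast le_top), ContinuousMultilinearMap.compContinuousLinearMap_apply,
    iteratedFDeriv_average_apply S.temperate (S.integrable_residual_pow hW)]

/-- The regression maps the basis vector of a cell to the ramps of this cell, so `boxDeriv` over
cells is the differential of `S.f` along images of basis vectors. Integrating out the independent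
residual leaves the partial derivative of `gridFun`. -/
theorem SmoothCylinder.condExp_boxDeriv (hW : IsPreBrownianReal W P) (hWm : ∀ t, Measurable (W t))
    (hΔ : 0 < Δ) (S : SmoothCylinder T) {l : ℕ} (β : Fin l → Fin M) :
    P[S.boxDeriv W (fun j => (cellLeft Δ (β j) : ℝ)) (fun j => cellRight Δ (β j)) |
        MeasurableSpace.comap (gridIncr W Δ M) inferInstance]
      =ᵐ[P] fun ω => iteratedFDeriv ℝ l (S.gridFun W P Δ M) (gridIncr W Δ M ω)
        fun j => Pi.single (β j) 1 := by
  have := hW.isGaussianProcess.isProbabilityMeasure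
  simp_rw [S.iteratedFDeriv_gridFun hW, regression_single]
  have hB : Measurable fun ω i =>
      residual W (cellLeft Δ (M := M)) (cellRight Δ) (S.time i) ω :=
    measurable_pi_lambda _ fun i => (measurable_pi_apply (S.time i)).comp
      (measurable_residual hWm _ _)
  let g : (Fin M → ℝ) × (Fin S.n → ℝ) → ℝ := fun p =>
    iteratedFDeriv ℝ l S.f (regression Δ M S.time p.1 + p.2)
      fun j i => ramp (cellLeft Δ (β j)) (cellRight Δ (β j)) (S.time i)
  have hg : Measurable g :=
    (continuous_iteratedFDeriv_apply S.temperate l _).measurable.comp (by fun_prop)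
  have e : (S.boxDeriv W (fun j => (cellLeft Δ (β j) : ℝ)) fun j => cellRight Δ (β j))
      = fun ω => g (gridIncr W Δ M ω,
        fun i => residual W (cellLeft Δ (M := M)) (cellRight Δ) (S.time i) ω) := by
    ext ω
    rw [SmoothCylinder.boxDeriv, regression_add_residual W Δ M]
  have hint := S.integrable_boxDeriv hW (fun j => (cellLeft Δ (β j) : ℝ))
    fun j => (cellRight Δ (β j) : ℝ)
  rw [e] at hint ⊢
  exact condExp_comp_prodMk_of_indep (measurable_gridIncr hWm Δ M).comap_le
    (comap_measurable _) hB (indepFun_gridIncr_residual hW hΔ S.time) hg hint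

theorem SmoothCylinder.condExp_eval (hW : IsPreBrownianReal W P) (hWm : ∀ t, Measurable (W t))
    (hΔ : 0 < Δ) (S : SmoothCylinder T) :
    P[S.eval W | MeasurableSpace.comap (gridIncr W Δ M) inferInstance]
      =ᵐ[P] fun ω => S.gridFun W P Δ M (gridIncr W Δ M ω) := by
  have h := S.condExp_boxDeriv (M := M) hW hWm hΔ (l := 0) Fin.elim0
  simp only [iteratedFDeriv_zero_apply] at h
  have e : (S.boxDeriv W (fun j : Fin 0 => (cellLeft Δ (Fin.elim0 j : Fin M) : ℝ))
      fun j => cellRight Δ (Fin.elim0 j : Fin M)) = S.eval W := by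
    ext ω
    simp [SmoothCylinder.boxDeriv, SmoothCylinder.eval]
  rwa [e] at h

/-- `F` is the limit in `L²` of smooth functions `f n` of the increments over the grid, whose
partial derivatives of order at most `K` also converge, to the functions `G` of these increments. -/
structure IsGridApprox (W : ℝ≥0 → Ω → ℝ) (P : Measure Ω) (Δ : ℝ≥0) {M : ℕ} (F : Ω → ℝ) (K : ℕ)
    (f : ℕ → (Fin M → ℝ) → ℝ) (G : (l : ℕ) → (Fin l → Fin M) → (Fin M → ℝ) → ℝ) : Prop where
  temperate : ∀ n, (f n).HasTemperateGrowth
  measurable : ∀ l β, Measurable (G l β)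
  tendsto : Tendsto (fun n => eLpNorm (fun ω => f n (gridIncr W Δ M ω) - F ω) 2 P) atTop (𝓝 0)
  memLp : ∀ l ≤ K, ∀ β, MemLp (fun ω => G l β (gridIncr W Δ M ω)) 2 P
  tendsto_deriv : ∀ l ≤ K, ∀ β, Tendsto (fun n => eLpNorm (fun ω =>
    iteratedFDeriv ℝ l (f n) (gridIncr W Δ M ω) (fun j => Pi.single (β j) 1)
      - G l β (gridIncr W Δ M ω)) 2 P) atTop (𝓝 0)

theorem tendsto_eLpNorm_condExp_sub {f : ℕ → Ω → ℝ} {g : Ω → ℝ} {m : MeasurableSpace Ω}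
    (hf : ∀ n, Integrable (f n) P) (hg : Integrable g P)
    (h : Tendsto (fun n => eLpNorm (fun ω => f n ω - g ω) 2 P) atTop (𝓝 0)) :
    Tendsto (fun n => eLpNorm (fun ω => (P[f n | m]) ω - (P[g | m]) ω) 2 P) atTop (𝓝 0) := by
  refine tendsto_of_tendsto_of_tendsto_of_le_of_le tendsto_const_nhds h (fun _ => zero_le)
    fun n => ?_
  have h1 : (fun ω => (P[f n | m]) ω - (P[g | m]) ω) =ᵐ[P] P[f n - g | m] :=
    (condExp_sub (hf n) hg m).symm
  rw [eLpNorm_congr_ae h1]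
  exact eLpNorm_condExp_le_eLpNorm (f n - g) (by norm_num)

/-- Conditional expectation contracts `L²`, so the projected functionals converge to the projection
of `F`, which is `F`. Their partial derivatives converge to the projections of the cell means of the
Malliavin derivatives; these define `G`. -/
theorem HasMalliavinDeriv.exists_isGridApprox (hW : IsPreBrownianReal W P)
    (hWm : ∀ t, Measurable (W t)) (hΔ : 0 < Δ) {F : Ω → ℝ} {K : ℕ} {U : Ω × (Fin K → ℝ) → ℝ}
    (hU : HasMalliavinDeriv W P (M * Δ) F K U)
    (hF : P[F | MeasurableSpace.comap (gridIncr W Δ M) inferInstance] =ᵐ[P] F) :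
    ∃ f G, IsGridApprox W P Δ (M := M) F K f G := by
  have := hW.isGaussianProcess.isProbabilityMeasure
  obtain ⟨hF2, V, S, -, hS, hV⟩ := hU
  have hex : ∀ (l : ℕ) (β : Fin l → Fin M), ∃ k : (Fin M → ℝ) → ℝ, Measurable k ∧
      P[fun ω => ∫ s, V l (ω, s) ∂(boxMeasure (fun j => (cellLeft Δ (β j) : ℝ))
        fun j => cellRight Δ (β j)) | MeasurableSpace.comap (gridIncr W Δ M) inferInstance]
        = k ∘ gridIncr W Δ M := fun l β => by
    obtain ⟨k, hk, hke⟩ := (stronglyMeasurable_condExp (f := fun ω => ∫ s, V l (ω, s)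
      ∂(boxMeasure (fun j => (cellLeft Δ (β j) : ℝ)) fun j => cellRight Δ (β j)))
      (m := MeasurableSpace.comap (gridIncr W Δ M) inferInstance)
      (μ := P)).exists_eq_measurable_comp
    exact ⟨k, hk.measurable, hke⟩
  choose G hGm hG using hex
  have hab : ∀ {l : ℕ} (β : Fin l → Fin M) (j : Fin l),
      (cellLeft Δ (β j) : ℝ) < cellRight Δ (β j) := fun β j => by
    exact_mod_cast cellLeft_lt_cellRight hΔ (β j)
  have h0 : ∀ {l : ℕ} (β : Fin l → Fin M) (j : Fin l), (0 : ℝ) ≤ cellLeft Δ (β j) :=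
    fun β j => NNReal.coe_nonneg _
  have hT : ∀ {l : ℕ} (β : Fin l → Fin M) (j : Fin l),
      (cellRight Δ (β j) : ℝ) ≤ (M * Δ : ℝ≥0) := fun β j => by
    exact_mod_cast cellRight_le Δ (β j)
  refine ⟨fun n => (S n).gridFun W P Δ M, G, fun n => (S n).hasTemperateGrowth_gridFun hW Δ M,
    hGm, ?_, fun l hl β => ?_, fun l hl β => ?_⟩
  · refine (tendsto_eLpNorm_condExp_sub
      (m := MeasurableSpace.comap (gridIncr W Δ M) inferInstance)
      (fun n => (S n).integrable_eval hW) (hF2.integrable (by norm_num)) hS).congr fun n => ?_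
    refine eLpNorm_congr_ae ?_
    filter_upwards [(S n).condExp_eval (M := M) hW hWm hΔ, hF] with ω h1 h2
    rw [h1, h2]
  · have h := (memLp_boxMean (hab β) (h0 β) (hT β) (hV l hl).1).condExp
      (m := MeasurableSpace.comap (gridIncr W Δ M) inferInstance) (by norm_num)
    rw [hG l β] at h
    exact h
  · refine (tendsto_eLpNorm_condExp_sub
      (m := MeasurableSpace.comap (gridIncr W Δ M) inferInstance)
      (fun n => (S n).integrable_boxDeriv hW _ _)
      ((memLp_boxMean (hab β) (h0 β) (hT β) (hV l hl).1).integrable (by norm_num))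
      (tendsto_boxDeriv hWm (hab β) (h0 β) (hT β) (hV l hl).1 (hV l hl).2)).congr fun n => ?_
    refine eLpNorm_congr_ae ?_
    filter_upwards [(S n).condExp_boxDeriv hW hWm hΔ β] with ω h1
    rw [h1, hG l β]
    rfl

end Projection

end BackwardTaylor

namespace BackwardTaylor

/-! ### Malliavin derivatives of functions of the grid increments -/

section Grid

variable {Ω : Type*} [MeasurableSpace Ω] {P : Measure Ω} {W : ℝ≥0 → Ω → ℝ} {Δ : ℝ≥0} {M : ℕ}

/-- The increments of a function on the points of the grid, as a linear map. -/
noncomputable def diffCLM (M : ℕ) : (Fin (M + 1) → ℝ) →L[ℝ] (Fin M → ℝ) :=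
  ContinuousLinearMap.pi fun j =>
    ContinuousLinearMap.proj (R := ℝ) (φ := fun _ : Fin (M + 1) => ℝ) j.succ
      - ContinuousLinearMap.proj (R := ℝ) (φ := fun _ : Fin (M + 1) => ℝ) j.castSucc

/-- A function of the increments over the grid, as a smooth cylindrical functional. -/
noncomputable def gridCylinder (Δ : ℝ≥0) {f : (Fin M → ℝ) → ℝ} (hf : f.HasTemperateGrowth) :
    SmoothCylinder (M * Δ) where
  n := M + 1
  time j := (j : ℕ) * Δ
  time_le j := by
    gcongr
    exact_mod_cast Nat.lt_succ_iff.1 j.2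
  f := f ∘ diffCLM M
  temperate := hf.comp (ContinuousLinearMap.hasTemperateGrowth _)

theorem diffCLM_grid {Ω : Type*} (W : ℝ≥0 → Ω → ℝ) (Δ : ℝ≥0) (ω : Ω) :
    diffCLM M (fun j : Fin (M + 1) => W ((j : ℕ) * Δ) ω) = gridIncr W Δ M ω := by
  ext j
  simp [diffCLM, gridIncr]

theorem gridCylinder_eval {Ω : Type*} (W : ℝ≥0 → Ω → ℝ) (Δ : ℝ≥0) {f : (Fin M → ℝ) → ℝ}
    (hf : f.HasTemperateGrowth) (ω : Ω) :
    (gridCylinder Δ hf).eval W ω = f (gridIncr W Δ M ω) := by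
  rw [← diffCLM_grid]
  rfl

/-- The cell with number `k` of the grid. -/
def cell (Δ : ℝ≥0) (k : ℕ) : Set ℝ := Set.Ioc (k * Δ) ((k + 1) * Δ)

/-- Cells are open on the left and closed on the right, in accordance with the indicator `1[s ≤ t]`;
hence a comparison with a grid point depends only on the number of the cell. -/
theorem le_mul_iff_of_mem_cell {k i : ℕ} {s : ℝ} (hs : s ∈ cell Δ k) :
    s ≤ i * Δ ↔ k + 1 ≤ i := by
  constructor
  · intro h
    by_contra hi
    have h1 : (i : ℝ) ≤ k := by exact_mod_cast Nat.lt_succ_iff.1 (not_le.1 hi)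
    have h2 : (i : ℝ) * Δ ≤ k * Δ := by gcongr
    exact absurd hs.1 (not_lt.2 (h.trans h2))
  · intro h
    have h1 : ((k : ℝ) + 1) ≤ i := by exact_mod_cast h
    exact hs.2.trans (by gcongr)

theorem eq_of_mem_cell {k k' : ℕ} {s : ℝ} (hs : s ∈ cell Δ k) (hs' : s ∈ cell Δ k') : k = k' := by
  have h1 := (le_mul_iff_of_mem_cell hs (i := k' + 1)).1 (by exact_mod_cast hs'.2)
  have h2 := (le_mul_iff_of_mem_cell hs' (i := k + 1)).1 (by exact_mod_cast hs.2)
  omega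

theorem exists_mem_cell (M : ℕ) {s : ℝ} (hs : s ∈ Set.Ioc (0 : ℝ) (M * Δ)) :
    ∃ k : Fin M, s ∈ cell Δ k := by
  induction M with
  | zero => simp at hs
  | succ M ih =>
    rcases le_or_gt s (M * Δ) with h | h
    · obtain ⟨k, hk⟩ := ih ⟨hs.1, h⟩
      exact ⟨k.castSucc, hk⟩
    · exact ⟨Fin.last M, h, by simpa using hs.2⟩

/-- On the grid points `1[s ≤ ·]` is a step function with a single jump, across the cell of `s`. -/
theorem diffCLM_indicator {k : Fin M} {s : ℝ} (hs : s ∈ cell Δ k) :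
    diffCLM M (fun j : Fin (M + 1) => if s ≤ (((j : ℕ) * Δ : ℝ≥0) : ℝ) then 1 else 0)
      = Pi.single k 1 := by
  ext j
  simp only [diffCLM, ContinuousLinearMap.coe_pi', sub_apply,
    ContinuousLinearMap.proj_apply, NNReal.coe_mul, NNReal.coe_natCast,
    le_mul_iff_of_mem_cell hs, Fin.val_succ, Fin.val_castSucc, Pi.single_apply, Fin.ext_iff]
  split_ifs <;> first | omega | simp

theorem gridCylinder_deriv {Ω : Type*} (W : ℝ≥0 → Ω → ℝ) {f : (Fin M → ℝ) → ℝ}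
    (hf : f.HasTemperateGrowth) {l : ℕ} {β : Fin l → Fin M} (ω : Ω) {s : Fin l → ℝ}
    (hs : ∀ j, s j ∈ cell Δ (β j)) :
    (gridCylinder Δ hf).deriv W l (ω, s)
      = iteratedFDeriv ℝ l f (gridIncr W Δ M ω) fun j => Pi.single (β j) 1 := by
  have h1 : (gridCylinder Δ hf).deriv W l (ω, s) = iteratedFDeriv ℝ l (f ∘ diffCLM M)
      (fun j : Fin (M + 1) => W ((j : ℕ) * Δ) ω)
      (fun (j : Fin l) (i : Fin (M + 1)) => if s j ≤ (((i : ℕ) * Δ : ℝ≥0) : ℝ) then 1 else 0) := rfl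
  rw [h1, ContinuousLinearMap.iteratedFDeriv_comp_right (n := (⊤ : ℕ∞)) _ hf.1 _
    (by exact_mod_cast le_top), ContinuousMultilinearMap.compContinuousLinearMap_apply,
    diffCLM_grid]
  congr 1
  ext1 j
  exact diffCLM_indicator (hs j)

/-- The function on `Ω × [0, T]^l` that equals `G β` on the product of the cells `β j`. -/
noncomputable def cellwise (Δ : ℝ≥0) {l : ℕ} (G : (Fin l → Fin M) → Ω → ℝ)
    (p : Ω × (Fin l → ℝ)) : ℝ :=
  ∑ β, (Set.univ.pi fun j => cell Δ (β j)).indicator (fun _ => G β p.1) p.2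

theorem cellwise_apply {Ω : Type*} {l : ℕ} (G : (Fin l → Fin M) → Ω → ℝ) {β : Fin l → Fin M}
    (ω : Ω) {s : Fin l → ℝ} (hs : ∀ j, s j ∈ cell Δ (β j)) : cellwise Δ G (ω, s) = G β ω := by
  rw [cellwise, Finset.sum_eq_single β]
  · exact Set.indicator_of_mem (show s ∈ Set.univ.pi fun j => cell Δ (β j) from fun j _ => hs j) _
  · intro γ _ hγ
    refine Set.indicator_of_notMem (fun h => hγ ?_) _
    ext j
    exact eq_of_mem_cell (h j trivial) (hs j)
  · simp

/-- The cells cover `(0, T]` but not `0`; the faces omitted are null sets. -/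
theorem timeProd_eq (P : Measure Ω) [SFinite P] (T : ℝ≥0) (l : ℕ) :
    timeProd P T l = P.prod (volume.restrict (Set.univ.pi fun _ => Set.Ioc (0 : ℝ) T)) := by
  rw [timeProd, Measure.restrict_congr_set]
  have h := Measure.univ_pi_Ioc_ae_eq_Icc (μ := fun _ : Fin l => (volume : Measure ℝ))
    (f := fun _ => 0) (g := fun _ => (T : ℝ))
  rw [← Set.pi_univ_Icc] at h
  exact h.symm

theorem ae_timeProd_exists_cell (P : Measure Ω) [SFinite P] (Δ : ℝ≥0) (M l : ℕ) :
    ∀ᵐ p ∂(timeProd P (M * Δ) l), ∃ β : Fin l → Fin M, ∀ j, p.2 j ∈ cell Δ (β j) := by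
  rw [timeProd_eq]
  have h : ∀ᵐ s : Fin l → ℝ ∂(volume.restrict (Set.univ.pi fun _ => Set.Ioc (0 : ℝ) (M * Δ : ℝ≥0))),
      ∃ β : Fin l → Fin M, ∀ j, s j ∈ cell Δ (β j) := by
    filter_upwards [ae_restrict_mem (MeasurableSet.univ_pi fun _ => measurableSet_Ioc)] with s hs
    choose β hβ using fun j => exists_mem_cell M (s := s j) (by simpa using hs j trivial)
    exact ⟨β, hβ⟩
  exact Measure.quasiMeasurePreserving_snd.ae h

theorem eLpNorm_comp_fst_timeProd (P : Measure Ω) [IsProbabilityMeasure P] (T : ℝ≥0) (l : ℕ)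
    {h : Ω → ℝ} (hh : AEStronglyMeasurable h P) :
    eLpNorm (fun p : Ω × (Fin l → ℝ) => h p.1) 2 (timeProd P T l)
      = (timeProd P T l Set.univ) ^ (1 / (2 : ℝ≥0∞)).toReal * eLpNorm h 2 P := by
  have h1 : (timeProd P T l).map Prod.fst = timeProd P T l Set.univ • P := by
    rw [timeProd, Measure.map_fst_prod, ← Set.univ_prod_univ, Measure.prod_prod]
    simp
  rw [← smul_eq_mul, ← eLpNorm_smul_measure_of_ne_top (by simp), ← h1, eLpNorm_map_measure]
  · rfl
  · rw [h1]; exact hh.smul_measure _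
  · exact measurable_fst.aemeasurable

theorem timeProd_univ_ne_top (P : Measure Ω) [IsProbabilityMeasure P] (T : ℝ≥0) (l : ℕ) :
    timeProd P T l Set.univ ≠ ∞ := by
  rw [timeProd_eq, ← Set.univ_prod_univ, Measure.prod_prod, Measure.restrict_apply_univ,
    measure_univ, one_mul]
  exact volume_box_ne_top _ _

theorem measurableSet_cells (Δ : ℝ≥0) {l : ℕ} (β : Fin l → Fin M) :
    MeasurableSet (Set.univ.pi fun j => cell Δ (β j)) :=
  MeasurableSet.univ_pi fun _ => measurableSet_Ioc

theorem aestronglyMeasurable_comp_fst_timeProd {P : Measure Ω} [SFinite P] {T : ℝ≥0} {l : ℕ}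
    {h : Ω → ℝ} (hh : AEStronglyMeasurable h P) :
    AEStronglyMeasurable (fun p : Ω × (Fin l → ℝ) => h p.1) (timeProd P T l) := hh.comp_fst

theorem indicator_cells_eq {Ω : Type*} (Δ : ℝ≥0) {l : ℕ} (β : Fin l → Fin M) (h : Ω → ℝ) :
    (fun p : Ω × (Fin l → ℝ) => (Set.univ.pi fun j => cell Δ (β j)).indicator (fun _ => h p.1) p.2)
      = (Prod.snd ⁻¹' (Set.univ.pi fun j => cell Δ (β j))).indicator fun p => h p.1 := by
  rfl

theorem aestronglyMeasurable_indicator_cells {P : Measure Ω} [SFinite P] {T : ℝ≥0} {l : ℕ}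
    (β : Fin l → Fin M) {h : Ω → ℝ} (hh : AEStronglyMeasurable h P) :
    AEStronglyMeasurable (fun p : Ω × (Fin l → ℝ) =>
      (Set.univ.pi fun j => cell Δ (β j)).indicator (fun _ => h p.1) p.2) (timeProd P T l) := by
  rw [indicator_cells_eq]
  exact (aestronglyMeasurable_comp_fst_timeProd hh).indicator
    (measurable_snd (measurableSet_cells Δ β))

theorem eLpNorm_cellwise_le {P : Measure Ω} [IsProbabilityMeasure P] {T : ℝ≥0} {l : ℕ}
    {G : (Fin l → Fin M) → Ω → ℝ} (hG : ∀ β, AEStronglyMeasurable (G β) P) :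
    eLpNorm (cellwise Δ G) 2 (timeProd P T l)
      ≤ ∑ β, (timeProd P T l Set.univ) ^ (1 / (2 : ℝ≥0∞)).toReal * eLpNorm (G β) 2 P := by
  have h1 : cellwise Δ G = ∑ β, fun p : Ω × (Fin l → ℝ) =>
      (Set.univ.pi fun j => cell Δ (β j)).indicator (fun _ => G β p.1) p.2 := by
    ext p
    simp [cellwise, Finset.sum_apply]
  rw [h1]
  refine (eLpNorm_sum_le (fun β _ => aestronglyMeasurable_indicator_cells β (hG β))
    (by norm_num)).trans (Finset.sum_le_sum fun β _ => ?_)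
  rw [indicator_cells_eq, ← eLpNorm_comp_fst_timeProd P T l (hG β)]
  exact eLpNorm_indicator_le _

theorem memLp_cellwise {P : Measure Ω} [IsProbabilityMeasure P] {T : ℝ≥0} {l : ℕ}
    {G : (Fin l → Fin M) → Ω → ℝ} (hG : ∀ β, MemLp (G β) 2 P) :
    MemLp (cellwise Δ G) 2 (timeProd P T l) := by
  refine ⟨?_, (eLpNorm_cellwise_le fun β => (hG β).1).trans_lt ?_⟩
  · unfold cellwise
    exact Finset.aestronglyMeasurable_fun_sum _ fun β _ =>
      aestronglyMeasurable_indicator_cells β (hG β).1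
  · refine ENNReal.sum_lt_top.2 fun β _ => ENNReal.mul_lt_top ?_ (hG β).2
    exact (ENNReal.rpow_ne_top_of_nonneg ENNReal.toReal_nonneg
      (timeProd_univ_ne_top P T l)).lt_top

/-- The derivatives of a functional of the grid increments are constant in time on products of
cells, so their convergence is that of finitely many partial derivatives. -/
theorem IsGridApprox.hasMalliavinDeriv [IsProbabilityMeasure P] (hWm : ∀ t, Measurable (W t))
    {F : Ω → ℝ} (hF : MemLp F 2 P) {K : ℕ}
    {f : ℕ → (Fin M → ℝ) → ℝ} {G : (l : ℕ) → (Fin l → Fin M) → (Fin M → ℝ) → ℝ}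
    (h : IsGridApprox W P Δ F K f G) {l : ℕ} (hl : l ≤ K) :
    HasMalliavinDeriv W P (M * Δ) F l (cellwise Δ fun β ω => G l β (gridIncr W Δ M ω)) := by
  refine ⟨hF, fun j => cellwise Δ fun β ω => G j β (gridIncr W Δ M ω),
    fun n => gridCylinder Δ (h.temperate n), rfl, ?_, fun j hj => ⟨?_, ?_⟩⟩
  · simp_rw [gridCylinder_eval]
    exact h.tendsto
  · exact memLp_cellwise (h.memLp j (hj.trans hl))
  · have hX := measurable_gridIncr hWm Δ M
    have hlim : Tendsto (fun n => ∑ β : Fin j → Fin M,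
        (timeProd P (M * Δ) j Set.univ) ^ (1 / (2 : ℝ≥0∞)).toReal * eLpNorm (fun ω =>
          iteratedFDeriv ℝ j (f n) (gridIncr W Δ M ω) (fun i => Pi.single (β i) 1)
            - G j β (gridIncr W Δ M ω)) 2 P) atTop (𝓝 0) := by
      have := tendsto_finsetSum (Finset.univ : Finset (Fin j → Fin M)) fun β _ =>
        ENNReal.Tendsto.const_mul (h.tendsto_deriv j (hj.trans hl) β)
          (Or.inr (ENNReal.rpow_ne_top_of_nonneg ENNReal.toReal_nonneg
            (timeProd_univ_ne_top P (M * Δ) j) : (timeProd P (M * Δ) j Set.univ) ^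
              (1 / (2 : ℝ≥0∞)).toReal ≠ ∞))
      simpa using this
    refine tendsto_of_tendsto_of_tendsto_of_le_of_le tendsto_const_nhds hlim (fun _ => zero_le)
      fun n => ?_
    refine le_trans (le_of_eq (eLpNorm_congr_ae ?_)) (eLpNorm_cellwise_le (Δ := Δ) fun β => ?_)
    · filter_upwards [ae_timeProd_exists_cell P Δ M j] with p ⟨β, hβ⟩
      obtain ⟨ω, s⟩ := p
      rw [gridCylinder_deriv W (h.temperate n) ω hβ, cellwise_apply _ ω hβ, cellwise_apply _ ω hβ]
    · exact (((continuous_iteratedFDeriv_apply (h.temperate n) j _).measurable.comp hX).sub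
        ((h.measurable j β).comp hX)).aestronglyMeasurable

/-- For `ε < Δ` the box `((m+1)Δ - ε, (m+1)Δ]^l` lies in a product of copies of the `m`-th cell,
where the derivative is constant in time: its means already equal the limit. -/
theorem IsGridApprox.hasMalliavinDerivAt [IsProbabilityMeasure P] (hWm : ∀ t, Measurable (W t))
    (hΔ : 0 < Δ) {F : Ω → ℝ} (hF : MemLp F 2 P) {K : ℕ}
    {f : ℕ → (Fin M → ℝ) → ℝ} {G : (l : ℕ) → (Fin l → Fin M) → (Fin M → ℝ) → ℝ}
    (h : IsGridApprox W P Δ F K f G) {l : ℕ} (hl : l ≤ K) (m : Fin M) :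
    HasMalliavinDerivAt W P (M * Δ) F l (((m : ℕ) + 1) * Δ)
      fun ω => G l (fun _ => m) (gridIncr W Δ M ω) := by
  refine ⟨h.memLp l hl _, _, h.hasMalliavinDeriv hWm hF hl, ?_⟩
  have hΔ' : (0 : ℝ) < Δ := by exact_mod_cast hΔ
  refine tendsto_const_nhds.congr' ?_
  filter_upwards [Ioo_mem_nhdsGT hΔ'] with ε hε
  have hab : ∀ _ : Fin l, (((((m : ℕ) + 1) * Δ : ℝ≥0) : ℝ) - ε) < (((m : ℕ) + 1) * Δ : ℝ≥0) :=
    fun _ => by linarith [hε.1]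
  have := isProbabilityMeasure_boxMeasure hab
  symm
  have e : ∀ ω, ⨍ s in Set.univ.pi (fun _ : Fin l =>
      Set.Ioc (((((m : ℕ) + 1) * Δ : ℝ≥0) : ℝ) - ε) (((m : ℕ) + 1) * Δ : ℝ≥0)),
      cellwise Δ (fun β ω => G l β (gridIncr W Δ M ω)) (ω, s)
        = G l (fun _ => m) (gridIncr W Δ M ω) := by
    intro ω
    rw [setAverage_box]
    have hae : ∀ᵐ s ∂(boxMeasure (fun _ : Fin l => ((((m : ℕ) + 1) * Δ : ℝ≥0) : ℝ) - ε)
        fun _ => (((m : ℕ) + 1) * Δ : ℝ≥0)),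
        cellwise Δ (fun β ω => G l β (gridIncr W Δ M ω)) (ω, s)
          = G l (fun _ => m) (gridIncr W Δ M ω) := by
      refine Measure.ae_smul_measure ?_ _
      filter_upwards [ae_restrict_mem (MeasurableSet.univ_pi fun _ => measurableSet_Ioc)] with s hs
      refine cellwise_apply (β := fun _ => m) _ ω fun j => ?_
      have hj := hs j trivial
      refine ⟨lt_of_le_of_lt ?_ hj.1, by simpa using hj.2⟩
      push_cast
      linarith [hε.2]
    rw [integral_congr_ae hae, integral_const, probReal_univ, one_smul]
  simp_rw [e]
  simp

end Grid

end BackwardTaylor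

namespace BackwardTaylor

/-! ### Taylor's formula in one variable for limits of smooth functions -/

section Taylor

variable {M : ℕ} {v : ℝ≥0}

/-- Resampling one coordinate from its own law preserves the product law. -/
theorem measurePreserving_update {ι : Type*} [Fintype ι] [DecidableEq ι] {α : Type*}
    [MeasurableSpace α] (κ : Measure α) [IsProbabilityMeasure κ] (m : ι) :
    MeasurePreserving (fun p : (ι → α) × α => Function.update p.1 m p.2)
      ((Measure.pi fun _ => κ).prod κ) (Measure.pi fun _ => κ) := by
  have hmeas : Measurable fun p : (ι → α) × α => Function.update p.1 m p.2 := by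
    refine measurable_pi_lambda _ fun i => ?_
    by_cases h : i = m
    · subst h; simpa using measurable_snd
    · simp only [Function.update_of_ne h]; fun_prop
  refine ⟨hmeas, (Measure.pi_eq fun s hs => ?_).symm⟩
  rw [Measure.map_apply hmeas (MeasurableSet.univ_pi hs)]
  have hpre : (fun p : (ι → α) × α => Function.update p.1 m p.2) ⁻¹' Set.univ.pi s
      = (Set.univ.pi (Function.update s m Set.univ)) ×ˢ s m := by
    ext p
    simp only [Set.mem_preimage, Set.mem_univ_pi, Set.mem_prod]
    constructor
    · intro h
      refine ⟨fun i => ?_, by simpa using h m⟩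
      by_cases hi : i = m
      · subst hi; simp
      · simpa [hi] using h i
    · rintro ⟨h1, h2⟩ i
      by_cases hi : i = m
      · subst hi; simpa using h2
      · simpa [hi] using h1 i
  rw [hpre, Measure.prod_prod, Measure.pi_pi, ← Finset.mul_prod_erase _ _ (Finset.mem_univ m),
    ← Finset.mul_prod_erase (Finset.univ) (fun i => κ (s i)) (Finset.mem_univ m)]
  simp only [Function.update_self, measure_univ, one_mul]
  rw [mul_comm]
  congr 1
  refine Finset.prod_congr rfl fun i hi => ?_
  rw [Function.update_of_ne (Finset.ne_of_mem_erase hi)]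

/-- On `[-N, N]` the density is at least its value at `N`. -/
theorem exists_volume_restrict_le_gaussianReal (hv : v ≠ 0) (N : ℝ) :
    ∃ K : ℝ≥0∞, K ≠ ∞ ∧ volume.restrict (Set.Icc (-N) N) ≤ K • gaussianReal 0 v := by
  have hpos := gaussianPDFReal_pos 0 v N hv
  refine ⟨(ENNReal.ofReal (gaussianPDFReal 0 v N))⁻¹,
    ENNReal.inv_ne_top.2 (by simpa using hpos), Measure.le_iff.2 fun s hs => ?_⟩
  rw [Measure.restrict_apply hs, Measure.smul_apply, smul_eq_mul, gaussianReal_apply 0 hv]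
  have h1 : ENNReal.ofReal (gaussianPDFReal 0 v N) * volume (s ∩ Set.Icc (-N) N)
      ≤ ∫⁻ x in s, gaussianPDF 0 v x := by
    rw [← setLIntegral_const]
    refine (setLIntegral_mono (measurable_gaussianPDF 0 v) fun x hx => ?_).trans
      (lintegral_mono_set Set.inter_subset_left)
    refine ENNReal.ofReal_le_ofReal ?_
    rw [gaussianPDFReal_def]
    have h2 : x ^ 2 ≤ N ^ 2 := sq_le_sq' hx.2.1 hx.2.2
    simp only [sub_zero]
    gcongr
  calc volume (s ∩ Set.Icc (-N) N)
      = (ENNReal.ofReal (gaussianPDFReal 0 v N))⁻¹ *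
          (ENNReal.ofReal (gaussianPDFReal 0 v N) * volume (s ∩ Set.Icc (-N) N)) := by
        rw [← mul_assoc, ENNReal.inv_mul_cancel (by simpa using hpos) ENNReal.ofReal_ne_top,
          one_mul]
    _ ≤ _ := by gcongr

theorem iteratedDeriv_update {f : (Fin M → ℝ) → ℝ} (hf : f.HasTemperateGrowth) (x : Fin M → ℝ)
    (m : Fin M) (l : ℕ) (s : ℝ) :
    iteratedDeriv l (fun s => f (Function.update x m s)) s
      = iteratedFDeriv ℝ l f (Function.update x m s) fun _ => Pi.single m 1 := by
  have h : ∀ s : ℝ, Function.update x m s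
      = Function.update x m 0 + s • (Pi.single m 1 : Fin M → ℝ) := fun s => by
    ext i
    by_cases hi : i = m
    · subst hi; simp
    · simp [hi]
  have h' : (fun s => f (Function.update x m s))
      = fun s => f (Function.update x m 0 + s • Pi.single m 1) := funext fun s => congrArg f (h s)
  rw [h', h s]
  exact iteratedDeriv_comp_line hf.1 _ _ l s

/-- The constant does not depend on `f`, so it survives the limit along the approximants. The
remainder is a Gaussian average over the resampled coordinate, which integration over `x` turns into
the full `L¹` norm. -/
theorem enorm_sub_taylor_update_le (hv : v ≠ 0) (L : ℕ) (N : ℝ) :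
    ∃ C : ℝ≥0∞, C ≠ ∞ ∧ ∀ {f : (Fin M → ℝ) → ℝ}, f.HasTemperateGrowth → ∀ (m : Fin M)
      (x : Fin M → ℝ) (y : ℝ), |x m| ≤ N → |y| ≤ N →
      ‖f (Function.update x m y) - ∑ l ∈ Finset.range (L + 1), (y - x m) ^ l / (l.factorial : ℝ)
          * iteratedFDeriv ℝ l f x (fun _ => Pi.single m 1)‖ₑ
        ≤ C * ∫⁻ s, ‖iteratedFDeriv ℝ (L + 1) f (Function.update x m s)
            (fun _ => Pi.single m 1)‖ₑ ∂(gaussianReal 0 v) := by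
  obtain ⟨K, hK, hle⟩ := exists_volume_restrict_le_gaussianReal hv N
  refine ⟨ENNReal.ofReal ((2 * N) ^ L / (L.factorial : ℝ)) * K,
    ENNReal.mul_ne_top ENNReal.ofReal_ne_top hK, fun {f} hf m x y hx hy => ?_⟩
  have hu : ContDiff ℝ (⊤ : ℕ∞) fun s => f (Function.update x m s) :=
    hf.1.comp (contDiff_update _ x m)
  have hN : 0 ≤ N := (abs_nonneg y).trans hy
  have h := abs_sub_taylor_le hu L hx hy
  simp only [iteratedDeriv_update hf, Function.update_eq_self] at h
  have hcont : Continuous fun s => iteratedFDeriv ℝ (L + 1) f (Function.update x m s)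
      fun _ => Pi.single m 1 :=
    (continuous_iteratedFDeriv_apply hf (L + 1) _).comp (continuous_const.update m continuous_id)
  rw [← ofReal_norm, Real.norm_eq_abs]
  refine (ENNReal.ofReal_le_ofReal h).trans ?_
  rw [ENNReal.ofReal_mul (by positivity), mul_assoc]
  gcongr
  rw [ofReal_integral_eq_lintegral_ofReal (hcont.abs.continuousOn.integrableOn_Icc)
    (ae_of_all _ fun _ => abs_nonneg _)]
  simp_rw [← Real.norm_eq_abs, ofReal_norm]
  refine (lintegral_mono' hle le_rfl).trans ?_
  rw [lintegral_smul_measure, smul_eq_mul]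

/-- A limit of smooth functions whose partial derivatives of order at most `L + 1` in one variable
converge, that of order `L + 1` to `0`, is a polynomial of degree at most `L` in this variable. -/
theorem ae_eq_taylor_of_tendsto (hv : v ≠ 0) (m : Fin M) (L : ℕ) {φ : (Fin M → ℝ) → ℝ}
    {f : ℕ → (Fin M → ℝ) → ℝ} {g : ℕ → (Fin M → ℝ) → ℝ} (hφ : Measurable φ)
    (hf : ∀ n, (f n).HasTemperateGrowth) (hg : ∀ l, Measurable (g l))
    (hlim : Tendsto (fun n => ∫⁻ x, ‖f n x - φ x‖ₑ ∂(Measure.pi fun _ => gaussianReal 0 v))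
      atTop (𝓝 0))
    (hderiv : ∀ l ≤ L, Tendsto (fun n => ∫⁻ x, ‖iteratedFDeriv ℝ l (f n) x
      (fun _ => Pi.single m 1) - g l x‖ₑ ∂(Measure.pi fun _ => gaussianReal 0 v)) atTop (𝓝 0))
    (hzero : Tendsto (fun n => ∫⁻ x, ‖iteratedFDeriv ℝ (L + 1) (f n) x
      (fun _ => Pi.single m 1)‖ₑ ∂(Measure.pi fun _ => gaussianReal 0 v)) atTop (𝓝 0)) :
    ∀ᵐ p ∂((Measure.pi fun _ : Fin M => gaussianReal 0 v).prod (gaussianReal 0 v)),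
      φ (Function.update p.1 m p.2)
        = ∑ l ∈ Finset.range (L + 1), (p.2 - p.1 m) ^ l / (l.factorial : ℝ) * g l p.1 := by
  set μ := Measure.pi fun _ : Fin M => gaussianReal 0 v with hμ
  set ν := μ.prod (gaussianReal 0 v) with hν
  have hup := measurePreserving_update (gaussianReal 0 v) m
  let Φ : (Fin M → ℝ) × ℝ → ℝ := fun p => φ (Function.update p.1 m p.2)
    - ∑ l ∈ Finset.range (L + 1), (p.2 - p.1 m) ^ l / (l.factorial : ℝ) * g l p.1
  have hΦ : Measurable Φ := by
    refine (hφ.comp hup.measurable).sub (Finset.measurable_fun_sum _ fun l _ => ?_)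
    have : Measurable fun p : (Fin M → ℝ) × ℝ => g l p.1 := (hg l).comp measurable_fst
    exact Measurable.mul (by fun_prop) this
  have hD : ∀ l n, Measurable fun x => iteratedFDeriv ℝ l (f n) x fun _ => Pi.single m 1 :=
    fun l n => (continuous_iteratedFDeriv_apply (hf n) l _).measurable
  -- The powers of `y - x m` and the remainder constant are bounded only locally, so the identity is
  -- proved for `|x m|, |y| ≤ N` and `N` is then exhausted.
  have hbox : ∀ N : ℕ, ∀ᵐ p ∂ν, |p.1 m| ≤ (N : ℝ) → |p.2| ≤ (N : ℝ) → Φ p = 0 := by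
    intro N
    obtain ⟨C, hC, hCle⟩ := enorm_sub_taylor_update_le (M := M) hv L (N : ℝ)
    let c : ℕ → ℝ≥0∞ := fun l => ENNReal.ofReal ((2 * N) ^ l / (l.factorial : ℝ))
    let s : Set ((Fin M → ℝ) × ℝ) := {p | |p.1 m| ≤ N ∧ |p.2| ≤ N}
    have hs : MeasurableSet s :=
      (measurableSet_le (f := fun p : (Fin M → ℝ) × ℝ => |p.1 m|) (g := fun _ => (N : ℝ))
        (by fun_prop) measurable_const).inter
        (measurableSet_le (f := fun p : (Fin M → ℝ) × ℝ => |p.2|) (g := fun _ => (N : ℝ))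
        (by fun_prop) measurable_const)
    have hpt : ∀ n, ∀ p ∈ s, ‖Φ p‖ₑ ≤ ‖f n (Function.update p.1 m p.2)
          - φ (Function.update p.1 m p.2)‖ₑ
        + (∑ l ∈ Finset.range (L + 1), c l * ‖iteratedFDeriv ℝ l (f n) p.1
          (fun _ => Pi.single m 1) - g l p.1‖ₑ)
        + C * ∫⁻ s, ‖iteratedFDeriv ℝ (L + 1) (f n) (Function.update p.1 m s)
            (fun _ => Pi.single m 1)‖ₑ ∂(gaussianReal 0 v) := by
      rintro n p ⟨hp1, hp2⟩
      -- Three errors: of the approximation of `φ`, of the Taylor coefficients, and the Taylor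
      -- remainder of `f n`.
      have e : Φ p = -(f n (Function.update p.1 m p.2) - φ (Function.update p.1 m p.2))
          + (∑ l ∈ Finset.range (L + 1), (p.2 - p.1 m) ^ l / (l.factorial : ℝ) *
            (iteratedFDeriv ℝ l (f n) p.1 (fun _ => Pi.single m 1) - g l p.1))
          + (f n (Function.update p.1 m p.2) - ∑ l ∈ Finset.range (L + 1),
            (p.2 - p.1 m) ^ l / (l.factorial : ℝ) *
              iteratedFDeriv ℝ l (f n) p.1 (fun _ => Pi.single m 1)) := by
        simp only [Φ, mul_sub, Finset.sum_sub_distrib]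
        ring
      rw [e]
      refine (enorm_add_le _ _).trans (add_le_add ((enorm_add_le _ _).trans (add_le_add ?_ ?_))
        (hCle (hf n) m p.1 p.2 hp1 hp2))
      · rw [enorm_neg]
      · refine (enorm_sum_le _ _).trans (Finset.sum_le_sum fun l _ => ?_)
        rw [enorm_mul]
        gcongr
        rw [← ofReal_norm, Real.norm_eq_abs]
        refine ENNReal.ofReal_le_ofReal ?_
        rw [abs_div, abs_pow, Nat.abs_cast]
        gcongr
        exact (abs_sub _ _).trans (by linarith)
    have hint : ∀ n, ∫⁻ p in s, ‖Φ p‖ₑ ∂ν ≤ ∫⁻ x, ‖f n x - φ x‖ₑ ∂μ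
        + (∑ l ∈ Finset.range (L + 1), c l * ∫⁻ x, ‖iteratedFDeriv ℝ l (f n) x
          (fun _ => Pi.single m 1) - g l x‖ₑ ∂μ)
        + C * ∫⁻ x, ‖iteratedFDeriv ℝ (L + 1) (f n) x (fun _ => Pi.single m 1)‖ₑ ∂μ := by
      intro n
      have hm1 : Measurable fun x => ‖f n x - φ x‖ₑ :=
        ((hf n).1.continuous.measurable.sub hφ).enorm
      have hm2 : ∀ l, Measurable fun x => ‖iteratedFDeriv ℝ l (f n) x
          (fun _ => Pi.single m 1) - g l x‖ₑ := fun l => ((hD l n).sub (hg l)).enorm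
      have hm3 : Measurable fun x => ‖iteratedFDeriv ℝ (L + 1) (f n) x
          (fun _ => Pi.single m 1)‖ₑ := (hD (L + 1) n).enorm
      have hm4 : Measurable fun x : Fin M → ℝ => ∫⁻ s, ‖iteratedFDeriv ℝ (L + 1) (f n)
          (Function.update x m s) (fun _ => Pi.single m 1)‖ₑ ∂(gaussianReal 0 v) :=
        (hm3.comp hup.measurable).lintegral_prod_right'
      have hm5 : Measurable fun p : (Fin M → ℝ) × ℝ => ∫⁻ s, ‖iteratedFDeriv ℝ (L + 1) (f n)
          (Function.update p.1 m s) (fun _ => Pi.single m 1)‖ₑ ∂(gaussianReal 0 v) :=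
        hm4.comp measurable_fst
      have hm6 : Measurable fun p : (Fin M → ℝ) × ℝ =>
          ‖f n (Function.update p.1 m p.2) - φ (Function.update p.1 m p.2)‖ₑ :=
        hm1.comp hup.measurable
      have hm7 : ∀ l, Measurable fun p : (Fin M → ℝ) × ℝ => ‖iteratedFDeriv ℝ l (f n) p.1
          (fun _ => Pi.single m 1) - g l p.1‖ₑ := fun l => (hm2 l).comp measurable_fst
      have hfst : ∀ {k : (Fin M → ℝ) → ℝ≥0∞}, Measurable k → ∫⁻ p, k p.1 ∂ν = ∫⁻ x, k x ∂μ :=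
        fun hk => measurePreserving_fst.lintegral_comp hk
      calc _ ≤ ∫⁻ p, (‖f n (Function.update p.1 m p.2) - φ (Function.update p.1 m p.2)‖ₑ
            + (∑ l ∈ Finset.range (L + 1), c l * ‖iteratedFDeriv ℝ l (f n) p.1
              (fun _ => Pi.single m 1) - g l p.1‖ₑ)
            + C * ∫⁻ s, ‖iteratedFDeriv ℝ (L + 1) (f n) (Function.update p.1 m s)
              (fun _ => Pi.single m 1)‖ₑ ∂(gaussianReal 0 v)) ∂ν :=
            (setLIntegral_mono' hs (hpt n)).trans (setLIntegral_le_lintegral _ _)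
        _ = _ := by
            rw [lintegral_add_right _ (hm5.const_mul C),
              lintegral_add_left hm6,
              hup.lintegral_comp (f := fun x => ‖f n x - φ x‖ₑ) hm1, lintegral_finsetSum _
                fun l _ => (hm7 l).const_mul (c l),
              lintegral_const_mul _ hm5]
            congr 2
            · refine Finset.sum_congr rfl fun l _ => ?_
              rw [lintegral_const_mul _ (hm7 l), hfst (hm2 l)]
            -- Averaging over `x` and over its resampled coordinate is averaging over `x` alone.
            · rw [hfst hm4, ← hup.lintegral_comp hm3]
              exact (lintegral_prod _ (hm3.comp hup.measurable).aemeasurable).symm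
    -- The left side of `hint` does not depend on `n`, while the right side tends to `0`.
    have hz : ∫⁻ p in s, ‖Φ p‖ₑ ∂ν = 0 := by
      refine le_antisymm (ge_of_tendsto' (x := atTop) ?_ hint) zero_le
      have h1 := tendsto_finsetSum (Finset.range (L + 1)) fun l hl =>
        ENNReal.Tendsto.const_mul (hderiv l (Nat.lt_succ_iff.1 (Finset.mem_range.1 hl)))
          (Or.inr (ENNReal.ofReal_ne_top : c l ≠ ∞))
      have h2 := (hlim.add h1).add (ENNReal.Tendsto.const_mul hzero (Or.inr hC))
      simpa using h2
    rw [lintegral_eq_zero_iff hΦ.enorm] at hz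
    filter_upwards [(ae_restrict_iff' hs).1 hz] with p hp h1 h2
    simpa using hp ⟨h1, h2⟩
  filter_upwards [ae_all_iff.2 hbox] with p hp
  obtain ⟨N, hN⟩ := exists_nat_ge (max |p.1 m| |p.2|)
  exact sub_eq_zero.1 (hp N ((le_max_left _ _).trans hN) ((le_max_right _ _).trans hN))

end Taylor

end BackwardTaylor

namespace BackwardTaylor

/-! ### Conditional expectations of functions of the grid increments -/

section GridFunctional

variable {Ω : Type*} [mΩ : MeasurableSpace Ω] {P : Measure Ω} {W : ℝ≥0 → Ω → ℝ} {Δ : ℝ≥0} {M : ℕ}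

theorem measurePreserving_gridIncr (hW : IsPreBrownianReal W P) (hWm : ∀ t, Measurable (W t))
    (Δ : ℝ≥0) (M : ℕ) :
    MeasurePreserving (gridIncr W Δ M) P (Measure.pi fun _ => gaussianReal 0 Δ) :=
  ⟨measurable_gridIncr hWm Δ M, map_gridIncr hW hWm Δ M⟩

/-- A random variable that is measurable with respect to the values on the grid is almost surely a
function of the increments over the grid. -/
theorem exists_ae_eq_comp_gridIncr (hW : IsPreBrownianReal W P) {F : Ω → ℝ}
    (hF : Measurable[⨆ j ∈ Set.Icc 1 M, MeasurableSpace.comap (W ((j : ℝ≥0) * Δ)) (borel ℝ)] F) :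
    ∃ φ : (Fin M → ℝ) → ℝ, Measurable φ ∧ F =ᵐ[P] fun ω => φ (gridIncr W Δ M ω) := by
  let Y : Ω → Fin M → ℝ := fun ω j => W (((j : ℕ) + 1) * Δ) ω
  have hle : (⨆ j ∈ Set.Icc 1 M, MeasurableSpace.comap (W ((j : ℝ≥0) * Δ)) (borel ℝ))
      ≤ MeasurableSpace.comap Y inferInstance := by
    refine iSup₂_le fun j hj => ?_
    have hj' : j - 1 < M := by have := hj.1; have := hj.2; omega
    have h : Measurable[MeasurableSpace.comap Y inferInstance] fun ω => Y ω ⟨j - 1, hj'⟩ :=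
      (measurable_pi_apply _).comp (comap_measurable Y)
    have e : (fun ω => Y ω ⟨j - 1, hj'⟩) = W ((j : ℝ≥0) * Δ) := by
      have : (((j - 1 : ℕ) : ℝ≥0) + 1) = j := by
        rw [← Nat.cast_add_one, Nat.sub_add_cancel hj.1]
      ext ω
      change W (((j - 1 : ℕ) + 1) * Δ) ω = _
      rw [this]
    rw [e] at h
    exact h.comap_le
  obtain ⟨ψ, hψ, rfl⟩ := (hF.mono hle le_rfl).exists_eq_measurable_comp
  -- The values on the grid are partial sums of the increments, as `W 0 = 0` almost surely.
  refine ⟨fun x => ψ fun j => ∑ k ∈ Finset.range (j + 1), if h : k < M then x ⟨k, h⟩ else 0,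
    hψ.comp (measurable_pi_lambda _ fun j => Finset.measurable_fun_sum _ fun k _ => ?_), ?_⟩
  · split_ifs
    · exact measurable_pi_apply _
    · exact measurable_const
  · filter_upwards [hW.eval_zero_ae_eq_zero] with ω hω
    refine congrArg ψ (funext fun j => ?_)
    have h : ∀ k ∈ Finset.range ((j : ℕ) + 1),
        (if h : k < M then gridIncr W Δ M ω ⟨k, h⟩ else 0)
          = W (((k + 1 : ℕ) : ℝ≥0) * Δ) ω - W ((k : ℝ≥0) * Δ) ω := fun k hk => by
      rw [dif_pos ((Finset.mem_range.1 hk).trans_le j.2)]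
      simp [gridIncr]
    rw [Finset.sum_congr rfl h, Finset.sum_range_sub fun k : ℕ => W ((k : ℝ≥0) * Δ) ω]
    simp [Y, hω]

theorem condExp_comap_gridIncr_of_ae_eq [IsProbabilityMeasure P] (hWm : ∀ t, Measurable (W t))
    {F : Ω → ℝ} (hF : Integrable F P) {φ : (Fin M → ℝ) → ℝ} (hφ : Measurable φ)
    (h : F =ᵐ[P] fun ω => φ (gridIncr W Δ M ω)) :
    P[F | MeasurableSpace.comap (gridIncr W Δ M) inferInstance] =ᵐ[P] F := by
  have hsm : StronglyMeasurable[MeasurableSpace.comap (gridIncr W Δ M) inferInstance]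
      fun ω => φ (gridIncr W Δ M ω) := (hφ.comp (comap_measurable _)).stronglyMeasurable
  have h1 := condExp_congr_ae (m := MeasurableSpace.comap (gridIncr W Δ M) inferInstance) h
  rw [condExp_of_stronglyMeasurable (measurable_gridIncr hWm Δ M).comap_le hsm (hF.congr h)] at h1
  exact h1.trans h.symm

/-- A value of the derivative is used only through conditional expectations given parts of `σ(W)`,
so agreement of integrals over events of `σ(W)` is enough. -/
theorem HasMalliavinDerivAt.condExp_eq {Ω : Type*} {m mΩ : MeasurableSpace Ω} {P : Measure Ω}
    {W : ℝ≥0 → Ω → ℝ} {T : ℝ≥0} (hW : IsPreBrownianReal W P)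
    (hWm : ∀ t, Measurable (W t)) (hm : m ≤ MeasurableSpace.comap (fun ω s => W s ω) inferInstance)
    {F G G' : Ω → ℝ} {l : ℕ} {t : ℝ≥0} (ht : 0 < t) (htT : t ≤ T)
    (hG : HasMalliavinDerivAt W P T F l t G) (hG' : HasMalliavinDerivAt W P T F l t G') :
    P[G | m] =ᵐ[P] P[G' | m] := by
  have := hW.isGaussianProcess.isProbabilityMeasure
  have hm' : m ≤ mΩ := hm.trans (measurable_pi_lambda (fun ω s => W s ω) hWm).comap_le
  have hGi : Integrable G P := hG.1.integrable (by norm_num)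
  refine ae_eq_condExp_of_forall_setIntegral_eq hm' (hG'.1.integrable (by norm_num))
    (fun _ _ _ => integrable_condExp.integrableOn) (fun s hs _ => ?_)
    stronglyMeasurable_condExp.aestronglyMeasurable
  rw [setIntegral_condExp hm' hGi hs]
  exact HasMalliavinDerivAt.setIntegral_eq hW hWm ht htT hG hG' (hm s hs)

theorem tendsto_lintegral_enorm_of_tendsto_eLpNorm [IsProbabilityMeasure P]
    (hW : IsPreBrownianReal W P) (hWm : ∀ t, Measurable (W t)) {k : ℕ → (Fin M → ℝ) → ℝ}
    (hk : ∀ n, Measurable (k n))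
    (h : Tendsto (fun n => eLpNorm (fun ω => k n (gridIncr W Δ M ω)) 2 P) atTop (𝓝 0)) :
    Tendsto (fun n => ∫⁻ x, ‖k n x‖ₑ ∂(Measure.pi fun _ => gaussianReal 0 Δ)) atTop (𝓝 0) := by
  refine tendsto_of_tendsto_of_tendsto_of_le_of_le tendsto_const_nhds h (fun _ => zero_le)
    fun n => ?_
  have hX := measurePreserving_gridIncr hW hWm Δ M
  dsimp only
  rw [← hX.lintegral_comp (hk n).enorm, ← eLpNorm_one_eq_lintegral_enorm]
  exact eLpNorm_le_eLpNorm_of_exponent_le (by norm_num)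
    ((hk n).comp hX.measurable).aestronglyMeasurable

/-- The vector that agrees with `x` before the index `j` and with `z` from `j` on. -/
def splice (j : ℕ) (x z : Fin M → ℝ) (i : Fin M) : ℝ := if (i : ℕ) < j then x i else z i

theorem measurable_splice (j : ℕ) :
    Measurable fun p : (Fin M → ℝ) × (Fin M → ℝ) => splice j p.1 p.2 := by
  refine measurable_pi_lambda _ fun i => ?_
  unfold splice
  split_ifs <;> fun_prop

/-- Coordinate `m` belongs to the tail of the splice at `m`, so conditioning at `(m+1)Δ` after
resampling it can be compared with conditioning at `mΔ`. -/
theorem update_splice (m : Fin M) (x z : Fin M → ℝ) (y : ℝ) :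
    Function.update (splice ((m : ℕ) + 1) x z) m y = splice m x (Function.update z m y) := by
  ext i
  rcases lt_trichotomy i m with h | rfl | h
  · have h' : (i : ℕ) < m := h
    simp [splice, h.ne, h', h'.trans (Nat.lt_succ_self _)]
  · simp [splice]
  · have h' : (m : ℕ) < i := h
    simp [splice, h.ne', h'.not_gt, not_lt.2 (Nat.succ_le_of_lt h')]

theorem measurable_natural (hWm : ∀ t, StronglyMeasurable (W t)) {s t : ℝ≥0} (h : s ≤ t) :
    Measurable[Filtration.natural W hWm t] (W s) :=
  ((Filtration.stronglyAdapted_natural hWm s).measurable).mono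
    ((Filtration.natural W hWm).mono h) le_rfl

theorem measurable_splice_gridIncr_zero (hWm : ∀ t, StronglyMeasurable (W t)) (Δ : ℝ≥0) (j : ℕ) :
    Measurable[Filtration.natural W hWm (j * Δ)] fun ω => splice j (gridIncr W Δ M ω) 0 := by
  refine @measurable_pi_lambda _ _ _ (Filtration.natural W hWm (j * Δ)) _ _ fun i => ?_
  unfold splice
  split_ifs with h
  · have h1 : (((i : ℕ) : ℝ≥0) + 1) * Δ ≤ j * Δ := by
      gcongr
      exact_mod_cast h
    have h2 : ((i : ℕ) : ℝ≥0) * Δ ≤ j * Δ := by gcongr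
    exact (measurable_natural hWm h1).sub (measurable_natural hWm h2)
  · exact measurable_const

theorem splice_splice_zero (j : ℕ) (x z : Fin M → ℝ) :
    splice j (splice j x 0) (splice j 0 z) = splice j x z := by
  ext i
  by_cases h : (i : ℕ) < j <;> simp [splice, h]

theorem splice_self (j : ℕ) (x : Fin M → ℝ) : splice j x x = x := by
  ext i
  simp [splice]

theorem futureIncr_eq_splice {Ω : Type*} (W : ℝ≥0 → Ω → ℝ) (Δ : ℝ≥0) (j : ℕ) (ω : Ω) :
    futureIncr W Δ M j ω = splice j 0 (gridIncr W Δ M ω) := by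
  ext i
  by_cases h : (i : ℕ) < j
  · simp [futureIncr, splice, h, h.not_ge]
  · simp [futureIncr, splice, h, not_lt.1 h]

theorem map_futureIncr (hW : IsPreBrownianReal W P) (hWm : ∀ t, Measurable (W t)) (Δ : ℝ≥0)
    (M j : ℕ) : P.map (futureIncr W Δ M j)
      = (Measure.pi fun _ => gaussianReal 0 Δ).map fun z => splice j 0 z := by
  have hs : Measurable fun z : Fin M → ℝ => splice j 0 z :=
    (measurable_splice j).comp (measurable_const.prodMk measurable_id)
  rw [← map_gridIncr hW hWm, Measure.map_map hs (measurable_gridIncr hWm Δ M)]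
  congr 1
  ext1 ω
  exact futureIncr_eq_splice W Δ j ω

/-- The freezing lemma for past and future increments. Integrating over the whole vector `z` is
harmless, since `splice` ignores its first `j` coordinates. The integrability for almost every `ω`
serves a later use of Fubini's theorem. -/
theorem condExp_comp_gridIncr (hW : IsPreBrownianReal W P) (hWm : ∀ t, StronglyMeasurable (W t))
    (j : ℕ) {φ : (Fin M → ℝ) → ℝ} (hφ : Measurable φ)
    (hint : Integrable (fun ω => φ (gridIncr W Δ M ω)) P) :
    (P[fun ω => φ (gridIncr W Δ M ω) | Filtration.natural W hWm (j * Δ)] =ᵐ[P] fun ω =>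
      ∫ z, φ (splice j (gridIncr W Δ M ω) z) ∂(Measure.pi fun _ => gaussianReal 0 Δ)) ∧
    ∀ᵐ ω ∂P, Integrable (fun z => φ (splice j (gridIncr W Δ M ω) z))
      (Measure.pi fun _ => gaussianReal 0 Δ) := by
  have := hW.isGaussianProcess.isProbabilityMeasure
  have hWm' := fun t => (hWm t).measurable
  have hm := (Filtration.natural W hWm).le (j * Δ)
  have hV := measurable_splice_gridIncr_zero (M := M) hWm Δ j
  have hs : Measurable fun z : Fin M → ℝ => splice j 0 z :=
    (measurable_splice j).comp (measurable_const.prodMk measurable_id)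
  have hZ : Measurable (futureIncr W Δ M j) := by
    have := hs.comp (measurable_gridIncr hWm' Δ M)
    convert this using 1
    ext1 ω
    exact futureIncr_eq_splice W Δ j ω
  have hind := indep_natural_futureIncr hW hWm Δ M j
  have hg : Measurable fun p : (Fin M → ℝ) × (Fin M → ℝ) => φ (splice j p.1 p.2) :=
    hφ.comp (measurable_splice j)
  -- The increments split into a part measurable at time `jΔ` and a part independent of it.
  have e : (fun ω => φ (gridIncr W Δ M ω))
      = fun ω => φ (splice j (splice j (gridIncr W Δ M ω) 0) (futureIncr W Δ M j ω)) := by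
    ext1 ω
    rw [futureIncr_eq_splice, splice_splice_zero, splice_self]
  have hgω : ∀ v : Fin M → ℝ, Measurable fun z => φ (splice j v z) := fun v =>
    hg.comp (measurable_const.prodMk measurable_id)
  rw [e] at hint
  constructor
  · rw [e]
    refine (condExp_comp_prodMk_of_indep hm hV hZ hind hg hint).trans
      (ae_of_all _ fun ω => ?_)
    dsimp only
    rw [map_futureIncr hW hWm', integral_map hs.aemeasurable (hgω _).aestronglyMeasurable]
    simp_rw [splice_splice_zero]
  · have h1 : Integrable (fun p : (Fin M → ℝ) × (Fin M → ℝ) => φ (splice j p.1 p.2))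
        ((P.map fun ω => splice j (gridIncr W Δ M ω) 0).prod (P.map (futureIncr W Δ M j))) := by
      rw [← map_prodMk_of_indep hm hV hZ hind, integrable_map_measure hg.aestronglyMeasurable
        ((hV.mono hm le_rfl).prodMk hZ).aemeasurable]
      exact hint
    have : IsProbabilityMeasure (P.map (futureIncr W Δ M j)) :=
      Measure.isProbabilityMeasure_map hZ.aemeasurable
    filter_upwards [ae_of_ae_map (hV.mono hm le_rfl).aemeasurable h1.prod_right_ae] with ω hω
    rw [map_futureIncr hW hWm', integrable_map_measure (hgω _).aestronglyMeasurable
      hs.aemeasurable] at hω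
    simpa [Function.comp_def, splice_splice_zero] using hω

/-- Averaging over the increment number `m` before conditioning on the values up to `(m + 1) Δ`
amounts to conditioning on the values up to `m Δ`. -/
theorem condExp_integral_update (hW : IsPreBrownianReal W P)
    (hWm : ∀ t, StronglyMeasurable (W t)) (m : Fin M) {φ : (Fin M → ℝ) → ℝ} (hφ : Measurable φ)
    (hint : Integrable (fun ω => φ (gridIncr W Δ M ω)) P) :
    Integrable (fun ω => ∫ y, φ (Function.update (gridIncr W Δ M ω) m y) ∂(gaussianReal 0 Δ)) P ∧
    P[fun ω => φ (gridIncr W Δ M ω) | Filtration.natural W hWm ((m : ℕ) * Δ)] =ᵐ[P]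
      P[fun ω => ∫ y, φ (Function.update (gridIncr W Δ M ω) m y) ∂(gaussianReal 0 Δ) |
        Filtration.natural W hWm (((m : ℕ) + 1) * Δ)] := by
  have hX := measurePreserving_gridIncr hW (fun t => (hWm t).measurable) Δ M
  have hup := measurePreserving_update (gaussianReal 0 Δ) m
  have hq : Measurable fun x : Fin M → ℝ => ∫ y, φ (Function.update x m y) ∂(gaussianReal 0 Δ) :=
    ((hφ.comp hup.measurable).stronglyMeasurable.integral_prod_right').measurable
  have hφi : Integrable φ (Measure.pi fun _ => gaussianReal 0 Δ) :=
    (hX.integrable_comp hφ.aestronglyMeasurable).1 hint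
  have hqi : Integrable (fun ω => ∫ y, φ (Function.update (gridIncr W Δ M ω) m y)
      ∂(gaussianReal 0 Δ)) P :=
    hX.integrable_comp_of_integrable
      ((hup.integrable_comp hφ.aestronglyMeasurable).2 hφi).integral_prod_left
  refine ⟨hqi, ?_⟩
  obtain ⟨h1, h2⟩ := condExp_comp_gridIncr hW hWm m hφ hint
  obtain ⟨h3, -⟩ := condExp_comp_gridIncr hW hWm (m + 1) hq hqi
  rw [Nat.cast_add_one] at h3
  -- Both sides are now integrals of `φ (splice m X ·)`, the right one with coordinate `m`
  -- resampled.
  refine h1.trans (Filter.EventuallyEq.trans ?_ h3.symm)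
  filter_upwards [h2] with ω hω
  simp_rw [update_splice]
  have h4 := (hup.integrable_comp hω.aestronglyMeasurable).2 hω
  have h5 := integral_prod _ h4
  simp only [Function.comp_def] at h5
  have h6 := integral_map (f := fun z => φ (splice m (gridIncr W Δ M ω) z))
    hup.measurable.aemeasurable (by rw [hup.map_eq]; exact hω.aestronglyMeasurable)
  rw [hup.map_eq] at h6
  exact h6.trans h5

/-- This yields both the square integrability of `γ(m, l)` and its measurability at time `(m+1)Δ`.
-/
theorem exists_polynomial_gamma {Ω : Type*} (W : ℝ≥0 → Ω → ℝ) (Δ : ℝ≥0) (m l : ℕ) :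
    ∃ p : Polynomial ℝ, ∀ ω, gamma W Δ m ω l = p.eval (W ((m + 1) * Δ) ω - W (m * Δ) ω) := by
  induction l using Nat.strong_induction_on with
  | _ l ih =>
    cases l with
    | zero => exact ⟨1, fun ω => by simp [gamma]⟩
    | succ l =>
      choose! p hp using ih
      refine ⟨Polynomial.C (if Even (l + 1) then
        ((Δ : ℝ) / 2) ^ ((l + 1) / 2) / (((l + 1) / 2).factorial : ℝ) else 0)
        - ∑ i : Fin (l + 1), p i * Polynomial.X ^ (l + 1 - (i : ℕ))
          * Polynomial.C ((l + 1 - (i : ℕ)).factorial : ℝ)⁻¹, fun ω => ?_⟩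
      rw [gamma, Polynomial.eval_sub, Polynomial.eval_C, Polynomial.eval_finsetSum]
      congr 1
      refine Finset.sum_congr rfl fun i _ => ?_
      rw [hp i i.2]
      simp [div_eq_mul_inv]
      ring

theorem memLp_polynomial_gaussianReal (v : ℝ≥0) (p : Polynomial ℝ) :
    MemLp (fun y => p.eval y) 2 (gaussianReal 0 v) := by
  refine (memLp_two_iff_integrable_sq p.continuous.aestronglyMeasurable).2 ?_
  simp_rw [← Polynomial.eval_pow, Polynomial.eval_eq_sum_range]
  exact integrable_finsetSum _ fun i _ => (integrable_pow_gaussianReal v i).const_mul _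

theorem memLp_gamma (hW : IsPreBrownianReal W P) (hWm : ∀ t, Measurable (W t)) (m : Fin M)
    (l : ℕ) : MemLp (fun ω => gamma W Δ m ω l) 2 P := by
  obtain ⟨p, hp⟩ := exists_polynomial_gamma W Δ m l
  have h := (measurePreserving_eval (fun _ : Fin M => gaussianReal 0 Δ) m).comp
    (measurePreserving_gridIncr hW hWm Δ M)
  simp_rw [hp]
  exact (memLp_polynomial_gaussianReal Δ p).comp_measurePreserving h

theorem stronglyMeasurable_gamma (hWm : ∀ t, StronglyMeasurable (W t)) (m l : ℕ) :
    StronglyMeasurable[Filtration.natural W hWm ((m + 1) * Δ)] fun ω => gamma W Δ m ω l := by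
  obtain ⟨p, hp⟩ := exists_polynomial_gamma W Δ m l
  simp_rw [hp]
  have h : (m : ℝ≥0) * Δ ≤ (m + 1) * Δ := by gcongr; simp
  exact (p.continuous.measurable.comp
    ((measurable_natural hWm le_rfl).sub (measurable_natural hWm h))).stronglyMeasurable

/-- The average of `F` over one increment is its backward Taylor expansion. -/
theorem IsGridApprox.ae_eq_sum_gamma [IsProbabilityMeasure P] (hW : IsPreBrownianReal W P)
    (hWm : ∀ t, Measurable (W t)) (hΔ : 0 < Δ) (m : Fin M) (L : ℕ) {F : Ω → ℝ}
    {f : ℕ → (Fin M → ℝ) → ℝ} {G : (l : ℕ) → (Fin l → Fin M) → (Fin M → ℝ) → ℝ}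
    (h : IsGridApprox W P Δ F (L + 1) f G) {φ : (Fin M → ℝ) → ℝ} (hφ : Measurable φ)
    (hF : F =ᵐ[P] fun ω => φ (gridIncr W Δ M ω))
    (hG : (fun ω => G (L + 1) (fun _ => m) (gridIncr W Δ M ω)) =ᵐ[P] 0) :
    (fun ω => ∫ y, φ (Function.update (gridIncr W Δ M ω) m y) ∂(gaussianReal 0 Δ)) =ᵐ[P]
      fun ω => ∑ l ∈ Finset.range (L + 1),
        gamma W Δ m ω l * G l (fun _ => m) (gridIncr W Δ M ω) := by
  have hv : Δ ≠ 0 := hΔ.ne'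
  have hD : ∀ l n, Measurable fun x => iteratedFDeriv ℝ l (f n) x fun _ => Pi.single m 1 :=
    fun l n => (continuous_iteratedFDeriv_apply (h.temperate n) l _).measurable
  have hlim := tendsto_lintegral_enorm_of_tendsto_eLpNorm (Δ := Δ) hW hWm
    (k := fun n x => f n x - φ x) (fun n => (h.temperate n).1.continuous.measurable.sub hφ) <| by
      refine h.tendsto.congr fun n => eLpNorm_congr_ae ?_
      filter_upwards [hF] with ω hω
      rw [hω]
  have hderiv : ∀ l ≤ L, _ := fun l hl => tendsto_lintegral_enorm_of_tendsto_eLpNorm (Δ := Δ) hW hWm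
    (k := fun n x => iteratedFDeriv ℝ l (f n) x (fun _ => Pi.single m 1) - G l (fun _ => m) x)
    (fun n => (hD l n).sub (h.measurable l _)) (h.tendsto_deriv l (hl.trans (Nat.le_succ L)) _)
  have hzero := tendsto_lintegral_enorm_of_tendsto_eLpNorm (Δ := Δ) hW hWm
    (k := fun n x => iteratedFDeriv ℝ (L + 1) (f n) x (fun _ => Pi.single m 1)) (hD (L + 1)) <| by
      refine (h.tendsto_deriv (L + 1) le_rfl fun _ => m).congr fun n => eLpNorm_congr_ae ?_
      filter_upwards [hG] with ω hω
      rw [hω]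
      simp
  have hT := ae_eq_taylor_of_tendsto hv m L hφ h.temperate (fun l => h.measurable l fun _ => m)
    hlim hderiv hzero
  -- Taylor's formula holds for almost every `x`, hence at `x = X(ω)`, and then for almost every
  -- `y`; it is integrated in `y`.
  filter_upwards [(measurePreserving_gridIncr hW hWm Δ M).quasiMeasurePreserving.ae
    (Measure.ae_ae_of_ae_prod hT)] with ω hω
  rw [integral_congr_ae hω, integral_finsetSum _ fun l _ =>
    ((integrable_sub_pow_gaussianReal Δ _ l).div_const _).mul_const _]
  refine Finset.sum_congr rfl fun l _ => ?_
  rw [integral_mul_const, integral_div, gamma_eq_integral W hv]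
  rfl

/-- The averaged expansion is conditioned at time `(m+1)Δ`, when `γ(m, l)` is known and factors out.
-/
theorem IsGridApprox.condExp_eq_sum_gamma [IsProbabilityMeasure P] (hW : IsPreBrownianReal W P)
    (hWm : ∀ t, StronglyMeasurable (W t)) (hΔ : 0 < Δ) (m : Fin M) (L : ℕ) {F : Ω → ℝ}
    (hFi : Integrable F P)
    {f : ℕ → (Fin M → ℝ) → ℝ} {G : (l : ℕ) → (Fin l → Fin M) → (Fin M → ℝ) → ℝ}
    (h : IsGridApprox W P Δ F (L + 1) f G) {φ : (Fin M → ℝ) → ℝ} (hφ : Measurable φ)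
    (hF : F =ᵐ[P] fun ω => φ (gridIncr W Δ M ω))
    (hG : (fun ω => G (L + 1) (fun _ => m) (gridIncr W Δ M ω)) =ᵐ[P] 0) :
    P[F | Filtration.natural W hWm ((m : ℕ) * Δ)] =ᵐ[P] fun ω => ∑ l ∈ Finset.range (L + 1),
      gamma W Δ m ω l * (P[fun ω => G l (fun _ => m) (gridIncr W Δ M ω) |
        Filtration.natural W hWm (((m : ℕ) + 1) * Δ)]) ω := by
  have hWm' := fun t => (hWm t).measurable
  obtain ⟨-, h1⟩ := condExp_integral_update hW hWm m hφ (hFi.congr hF)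
  have h2 := h.ae_eq_sum_gamma hW hWm' hΔ m L hφ hF hG
  have hGm : ∀ l ∈ Finset.range (L + 1), MemLp (fun ω => G l (fun _ => m) (gridIncr W Δ M ω)) 2 P :=
    fun l hl => h.memLp l (Finset.mem_range.1 hl).le _
  have hi : ∀ l ∈ Finset.range (L + 1), Integrable ((fun ω => gamma W Δ m ω l)
      * fun ω => G l (fun _ => m) (gridIncr W Δ M ω)) P := fun l hl =>
    (memLp_gamma hW hWm' m l).integrable_mul (hGm l hl)
  have h3 : (fun ω => ∑ l ∈ Finset.range (L + 1),
        gamma W Δ m ω l * G l (fun _ => m) (gridIncr W Δ M ω))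
      = ∑ l ∈ Finset.range (L + 1), (fun ω => gamma W Δ m ω l)
      * fun ω => G l (fun _ => m) (gridIncr W Δ M ω) := by
    ext ω
    simp
  refine (condExp_congr_ae hF).trans (h1.trans ((condExp_congr_ae h2).trans ?_))
  rw [h3]
  refine (condExp_finsetSum hi _).trans ?_
  have h4 : ∀ l ∈ Finset.range (L + 1), _ := fun l hl =>
    condExp_mul_of_stronglyMeasurable_left (m := Filtration.natural W hWm (((m : ℕ) + 1) * Δ))
      (stronglyMeasurable_gamma hWm (m : ℕ) l) (hi l hl)
      ((hGm l hl).integrable (by norm_num))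
  filter_upwards [(Finset.eventually_all _).2 h4] with ω hω
  rw [Finset.sum_apply]
  exact Finset.sum_congr rfl hω

end GridFunctional

end BackwardTaylor

/-! ### The backward Taylor expansion -/

theorem theorem1 {Ω : Type*} [MeasurableSpace Ω] (P : Measure Ω) [IsProbabilityMeasure P]
    (W : ℝ≥0 → Ω → ℝ) (hWmeas : ∀ t, StronglyMeasurable (W t)) (hW : IsBrownianReal W P)
    (Δ : ℝ≥0) (hΔ : 0 < Δ) (M m : ℕ) (hm : m + 1 ≤ M) (L : ℕ) (F : Ω → ℝ)
    (hFsmooth : BackwardTaylor.MalliavinSmooth W P (M * Δ) F)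
    (hFmeas : Measurable[⨆ j ∈ Set.Icc 1 M, MeasurableSpace.comap (W ((j : ℝ≥0) * Δ)) (borel ℝ)] F)
    (hFvanish : ∀ l > L, BackwardTaylor.HasMalliavinDerivAt W P (M * Δ) F l ((m + 1) * Δ) 0) :
    (∀ l, ∃ G, BackwardTaylor.HasMalliavinDerivAt W P (M * Δ) F l ((m + 1) * Δ) G) ∧
    ∀ D : ℕ → Ω → ℝ,
      (∀ l ≤ L, BackwardTaylor.HasMalliavinDerivAt W P (M * Δ) F l ((m + 1) * Δ) (D l)) →
      P[F | Filtration.natural W hWmeas (m * Δ)] =ᵐ[P]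
        fun ω => ∑ l ∈ Finset.range (L + 1), BackwardTaylor.gamma W Δ m ω l *
          (P[D l | Filtration.natural W hWmeas ((m + 1) * Δ)]) ω := by
  have hB := hW.toIsPreBrownianReal
  have hWm := fun t => (hWmeas t).measurable
  have hF2 : MemLp F 2 P := (hFsmooth 0).elim fun _ h => h.1
  have hFi : Integrable F P := hF2.integrable (by norm_num)
  obtain ⟨φ, hφ, hFφ⟩ := BackwardTaylor.exists_ae_eq_comp_gridIncr hB hFmeas
  have hFc := BackwardTaylor.condExp_comap_gridIncr_of_ae_eq hWm hFi hφ hFφ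
  have ht : 0 < ((m : ℝ≥0) + 1) * Δ := by positivity
  have htT : ((m : ℝ≥0) + 1) * Δ ≤ M * Δ := by
    gcongr
    exact_mod_cast hm
  have hex : ∀ K, ∃ f G, BackwardTaylor.IsGridApprox W P Δ (M := M) F K f G := fun K =>
    (hFsmooth K).elim fun _ hU => hU.exists_isGridApprox hB hWm hΔ hFc
  refine ⟨fun l => ?_, fun D hD => ?_⟩
  · obtain ⟨f, G, h⟩ := hex l
    exact ⟨_, h.hasMalliavinDerivAt hWm hΔ hF2 le_rfl ⟨m, hm⟩⟩
  -- A single approximating sequence must control the derivatives up to order `L + 1`, that of the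
  -- Taylor remainder.
  · obtain ⟨f, G, h⟩ := hex (L + 1)
    have hval := fun l (hl : l ≤ L + 1) => h.hasMalliavinDerivAt hWm hΔ hF2 hl ⟨m, hm⟩
    have hW' : Measurable fun ω s => W s ω := measurable_pi_lambda _ hWm
    -- By uniqueness `G (L + 1)` at the increments has the same conditional expectation given `σ(W)`
    -- as `0`; being `σ(W)`-measurable, it vanishes.
    have hzero : (fun ω => G (L + 1) (fun _ => ⟨m, hm⟩) (BackwardTaylor.gridIncr W Δ M ω))
        =ᵐ[P] 0 := by
      have h1 := BackwardTaylor.HasMalliavinDerivAt.condExp_eq hB hWm le_rfl ht htT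
        (hval (L + 1) le_rfl) (hFvanish (L + 1) (Nat.lt_succ_self L))
      have hX : Measurable[MeasurableSpace.comap (fun ω s => W s ω) inferInstance]
          (BackwardTaylor.gridIncr W Δ M) :=
        (BackwardTaylor.measurable_gridIncr (W := fun t (w : ℝ≥0 → ℝ) => w t)
          measurable_pi_apply Δ M).comp (comap_measurable fun ω s => W s ω)
      have hG : StronglyMeasurable[MeasurableSpace.comap (fun ω s => W s ω) inferInstance]
          fun ω => G (L + 1) (fun _ => ⟨m, hm⟩) (BackwardTaylor.gridIncr W Δ M ω) :=
        ((h.measurable (L + 1) _).comp hX).stronglyMeasurable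
      rw [condExp_zero, condExp_of_stronglyMeasurable hW'.comap_le hG ((hval (L + 1) le_rfl).1.integrable
        (by norm_num))] at h1
      exact h1
    have hle : (Filtration.natural W hWmeas (((m : ℝ≥0) + 1) * Δ) : MeasurableSpace Ω)
        ≤ MeasurableSpace.comap (fun ω s => W s ω) inferInstance := by
      refine iSup₂_le fun s _ => ?_
      have h1 : Measurable[MeasurableSpace.comap (fun ω s => W s ω) inferInstance] (W s) :=
        (measurable_pi_apply s).comp (comap_measurable fun ω s => W s ω)
      exact h1.comap_le
    -- Any admissible `D l` may replace the value built from the approximation, inside the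
    -- conditional expectation.
    have hcond : ∀ l ∈ Finset.range (L + 1), _ := fun l hl =>
      BackwardTaylor.HasMalliavinDerivAt.condExp_eq hB hWm hle ht htT
        (hval l (Finset.mem_range.1 hl).le) (hD l (Nat.lt_succ_iff.1 (Finset.mem_range.1 hl)))
    have hmain := h.condExp_eq_sum_gamma hB hWmeas hΔ ⟨m, hm⟩ L hFi hφ hFφ hzero
    refine hmain.trans ?_
    filter_upwards [(Finset.eventually_all _).2 hcond] with ω hω
    exact Finset.sum_congr rfl fun l hl => by rw [hω l hl]
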